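/- Write $x=(x_1,x_2)\in\mathbb R^3\times\mathbb R^3=\mathbb R^6$, $|x|_\infty=\max\{|x_1|,|x_2|\}$ and $|x|_0=\min\{|x_1|,|x_2|\}$. For $U\in\mathbb R$ let $$H_U=p_1^2+p_2^2-\frac1{|x_1|}-\frac1{|x_2|}+\frac{U}{|x_1-x_2|},\qquad p_i=-i\nabla_{x_i},$$ be the self-adjoint operator in $L^2(\mathbb R^6)$ with domain $H^2(\mathbb R^6)$. Let $0<\delta<1$, $0<\tau<1$, $0<K<2$ and $U\ge 1+\delta$, put $A_\delta=\{x\in\mathbb R^6: |x|_0\ge\delta|x|_\infty\}$, and define $$F(x)=\begin{cases}\dfrac{1}{4\left(1+\frac{\pi}{\tau\delta}\right)}\,|x|_\infty, & x \text{ in the interior of } A_\delta,\\[3mm] K\sqrt{\dfrac{U-1-\delta}{2+2\delta}}\,\sqrt{|x|_\infty}, & \text{otherwise.}\end{cases}$$ If $\psi_U$ lies in the domain of $H_U$ and $H_U\psi_U=-\frac14\psi_U$, then $e^F\psi_U\in L^2(\mathbb R^6)$. -/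

import Mathlib

open MeasureTheory
open scoped ENNReal SchwartzMap Laplacian

namespace HeliumAtom

/-- The configuration space `ℝ⁶ = ℝ³ × ℝ³` of the two electrons, with its Euclidean structure.
The positions of the electrons are `x.fst` and `x.snd`. -/
abbrev Config : Type :=
  WithLp 2 (EuclideanSpace ℝ (Fin 3) × EuclideanSpace ℝ (Fin 3))

/-- The Hilbert space `L²(ℝ⁶)` of complex-valued functions. -/
abbrev StateSpace : Type := Lp ℂ 2 (volume : Measure Config)

/-- The potential `- 1 / |x₁| - 1 / |x₂| + U / |x₁ - x₂|`; its values on the null set where a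
denominator vanishes are irrelevant. -/
noncomputable def potential (U : ℝ) (x : Config) : ℝ :=
  -(1 / ‖x.fst‖) - 1 / ‖x.snd‖ + U / ‖x.fst - x.snd‖

/-- `IsHamiltonianImage U ψ φ` says that `ψ` lies in the domain of the self-adjoint operator
`H_U = p₁² + p₂² - 1 / |x₁| - 1 / |x₂| + U / |x₁ - x₂|` and that `H_U ψ = φ`.
The domain is the Sobolev space `H²(ℝ⁶)`, and `p₁² + p₂² = -Δ` is the (negative) distributional
Laplacian on `ℝ⁶`, which maps `H²(ℝ⁶)` to `L²(ℝ⁶)`; here `T` is the `L²` function `-Δ ψ`. -/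
def IsHamiltonianImage (U : ℝ) (ψ φ : StateSpace) : Prop :=
  TemperedDistribution.MemSobolev 2 2 (ψ : 𝓢'(Config, ℂ)) ∧
    ∃ T : StateSpace, (T : 𝓢'(Config, ℂ)) = -Δ (ψ : 𝓢'(Config, ℂ)) ∧
      ∀ᵐ x : Config, φ x = T x + (potential U x : ℂ) * ψ x

/-- `|x|_∞ = max {|x₁|, |x₂|}`. -/
noncomputable def normMax (x : Config) : ℝ := max ‖x.fst‖ ‖x.snd‖

/-- `|x|_0 = min {|x₁|, |x₂|}`. -/
noncomputable def normMin (x : Config) : ℝ := min ‖x.fst‖ ‖x.snd‖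

/-- The region `A_δ`, where `|x|_0 ≥ δ |x|_∞`. -/
def region (δ : ℝ) : Set Config := {x | δ * normMax x ≤ normMin x}

open Classical in
/-- The decay exponent `F`: linear in `|x|_∞` in the interior of `A_δ`, and a multiple of
`√|x|_∞` elsewhere. -/
noncomputable def decayExponent (U δ τ K : ℝ) (x : Config) : ℝ :=
  if x ∈ interior (region δ) then
    1 / (4 * (1 + Real.pi / (τ * δ))) * normMax x
  else
    K * √((U - 1 - δ) / (2 + 2 * δ)) * √(normMax x)

end HeliumAtom

/-!
Weighted energy (Agmon) estimate for the eigenvalue equation at the ionization threshold `-1/4`.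

For a bounded weight `e^{2G}` and a real vector field `z`, integration by parts and the square
`|∇ψ + (∇G + z) ψ|² ≥ 0` give `∫ e^{2G} (1/4 + V + div z - |z|² - |∇G|²) |ψ|² ≤ 0` for a solution of
`H_U ψ = -ψ/4`, where `V` is the potential (`sobolev_energy_bound`, `weighted_energy_le_zero`). The
inequality is proved for Schwartz functions first; these approximate `ψ` and `Δψ` in `L²` at the same
time (`exists_schwartz_tendsto`).

The field `z` encodes the hydrogen ground state. In `ℝ³` the field `x / (2|x|)` satisfies
`div z - |z|² = 1/|x| - 1/4`, so that it compensates the attraction of the nucleus at the cost of the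
hydrogen energy `1/4`. It is applied to the inner electron only, through the cutoff `coneCutoff`,
which is supported where this electron is much closer to the nucleus than the other one. The errors
of the cutoff are of lower order (`blockEnergy_cone_ge`). As a result, at infinity the density
`1/4 + V + div z - |z|²` is bounded below (`farGap_le_energyDensity`) by nearly `1/4` where
`|x|_0 ≥ d |x|_∞`, and by nearly `(U / (1 + d) - 1) / |x|_∞` elsewhere: there the outer electron is
attracted by the nucleus with charge `1` and repelled by the inner electron at a distance of at most
`(1 + d) |x|_∞`. The field is singular at the nucleus, so `|x|` is replaced by `√(ε² + |x|²)` and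
`ε → 0` afterwards; `integrable_coulomb` provides the dominating function.

Whenever `|∇G|²` stays below this gap, `e^G ψ` is square integrable up to a polynomial factor
(`integrable_exp_mul_of_gap`). With `d = δ/16` two choices of `G` suffice: a multiple of `√|x|`
(`integrable_exp_sqrt`), and a function that is linear inside `A_δ` and nearly constant where
`|x|_0 < d |x|_∞` (`integrable_one_add_exp_conePhase`). Since `d < δ`, both beat `F` in their
regions with room to spare.
-/

namespace HeliumAtom

/-! ### Approximation of `H²` functions by Schwartz functions -/

section Approximation

open FourierTransform TemperedDistribution Filter Topology

variable {E : Type*} [NormedAddCommGroup E] [InnerProductSpace ℝ E] [FiniteDimensional ℝ E]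
  [MeasurableSpace E] [BorelSpace E]

theorem toTemperedDistribution_injective :
    Function.Injective (fun f : Lp ℂ 2 (volume : Measure E) => (f : 𝓢'(E, ℂ))) := by
  have h := Lp.ker_toTemperedDistributionCLM_eq_bot (F := ℂ) (μ := (volume : Measure E)) (p := 2)
  exact LinearMap.ker_eq_bot.mp h

theorem continuous_Linfty_smul (B : Lp ℂ ∞ (volume : Measure E)) :
    Continuous (fun u : Lp ℂ 2 (volume : Measure E) => (B • u : Lp ℂ 2 (volume : Measure E))) := by
  refine LipschitzWith.continuous (K := ‖B‖₊) (LipschitzWith.of_dist_le_mul fun u v => ?_)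
  have h : (B • u - B • v : Lp ℂ 2 (volume : Measure E)) = B • (u - v) := by
    rw [sub_eq_add_neg, sub_eq_add_neg, Lp.add_smul, Lp.smul_neg]
  rw [dist_eq_norm, dist_eq_norm, h]
  exact Lp.norm_smul_le _ _

/-- A Fourier multiplier with a bounded symbol acts continuously on `L²`, compatibly with its
action on tempered distributions and on Schwartz functions. -/
theorem exists_L2_multiplier {g : E → ℂ} (hg : g.HasTemperateGrowth) {C : ℝ}
    (hC : ∀ x, ‖g x‖ ≤ C) :
    ∃ A : Lp ℂ 2 (volume : Measure E) → Lp ℂ 2 (volume : Measure E), Continuous A ∧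
      (∀ v, ((A v : Lp ℂ 2 (volume : Measure E)) : 𝓢'(E, ℂ)) =
        fourierMultiplierCLM ℂ g (v : 𝓢'(E, ℂ))) ∧
      ∀ v : 𝓢(E, ℂ), A (v.toLp 2) = (SchwartzMap.fourierMultiplierCLM ℂ g v).toLp 2 := by
  have hmem : MemLp g ∞ (volume : Measure E) :=
    memLp_top_of_bound hg.1.continuous.aestronglyMeasurable C (ae_of_all _ hC)
  have key : ∀ v : Lp ℂ 2 (volume : Measure E),
      ((𝓕⁻ ((hmem.toLp g) • (𝓕 v) : Lp ℂ 2 (volume : Measure E)) :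
        Lp ℂ 2 (volume : Measure E)) : 𝓢'(E, ℂ)) =
        fourierMultiplierCLM ℂ g (v : 𝓢'(E, ℂ)) := by
    intro v
    rw [fourierMultiplierCLM_apply, ← Lp.fourierInv_toTemperedDistribution_eq,
      Lp.toTemperedDistribution_smul_eq hg, Lp.fourier_toTemperedDistribution_eq]
  refine ⟨fun v => 𝓕⁻ ((hmem.toLp g) • (𝓕 v) : Lp ℂ 2 (volume : Measure E)), ?_, key, ?_⟩
  · exact continuous_fourierInv.comp ((continuous_Linfty_smul _).comp continuous_fourier)
  · intro v
    apply toTemperedDistribution_injective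
    simp only [key]
    rw [Lp.toTemperedDistribution_toLp_eq, Lp.toTemperedDistribution_toLp_eq,
      fourierMultiplierCLM_toTemperedDistributionCLM_eq hg]

/-- Schwartz functions are dense in `H²` with the graph norm of the Laplacian: if `v` is the `L²`
function `(1 - Δ / (2π)²) ψ` and `vₙ → v`, the approximants are `(1 - Δ / (2π)²)⁻¹ vₙ`. -/
theorem exists_schwartz_tendsto {ψ T : Lp ℂ 2 (volume : Measure E)}
    (hψ : MemSobolev 2 2 (ψ : 𝓢'(E, ℂ))) (hT : (T : 𝓢'(E, ℂ)) = -Δ (ψ : 𝓢'(E, ℂ))) :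
    ∃ f : ℕ → 𝓢(E, ℂ), Tendsto (fun n => (f n).toLp 2 volume) atTop (𝓝 ψ) ∧
      Tendsto (fun n => (-Δ (f n)).toLp 2 volume) atTop (𝓝 T) := by
  obtain ⟨v, hv⟩ := hψ
  let g₁ : E → ℂ := fun x => (((1 + ‖x‖ ^ 2) ^ (-2 / 2 : ℝ) : ℝ) : ℂ)
  let g₂ : E → ℂ := fun x => ((‖x‖ ^ 2 : ℝ) : ℂ)
  have hg₁ : g₁.HasTemperateGrowth := by fun_prop
  have hg₂ : g₂.HasTemperateGrowth := by fun_prop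
  have hg₁v : ∀ x, g₁ x = (((1 + ‖x‖ ^ 2)⁻¹ : ℝ) : ℂ) := by
    intro x
    simp only [g₁]
    rw [show (-2 / 2 : ℝ) = -1 by norm_num, Real.rpow_neg_one]
  have hb₁ : ∀ x, ‖g₁ x‖ ≤ 1 := by
    intro x
    rw [hg₁v, Complex.norm_real, Real.norm_of_nonneg (by positivity)]
    exact inv_le_one_of_one_le₀ (by nlinarith [sq_nonneg ‖x‖])
  have hb₂ : ∀ x, ‖(g₁ * g₂) x‖ ≤ 1 := by
    intro x
    rw [Pi.mul_apply, hg₁v, ← Complex.ofReal_mul, Complex.norm_real,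
      Real.norm_of_nonneg (by positivity), inv_mul_le_iff₀ (by positivity)]
    linarith
  obtain ⟨A₁, hA₁c, hA₁, hA₁s⟩ := exists_L2_multiplier hg₁ hb₁
  obtain ⟨A₂, hA₂c, hA₂, hA₂s⟩ := exists_L2_multiplier (hg₁.mul hg₂) hb₂
  have hψv : A₁ v = ψ := by
    apply toTemperedDistribution_injective
    simp only [hA₁, ← hv]
    have h := (besselPotential_neg_apply_eq_iff 2
      (besselPotential E ℂ 2 (ψ : 𝓢'(E, ℂ))) (ψ : 𝓢'(E, ℂ))).mpr rfl
    exact h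
  have hTv : ((2 * Real.pi) ^ 2 : ℝ) • A₂ v = T := by
    apply toTemperedDistribution_injective
    simp only [hT]
    rw [← hψv, hA₁, laplacian_eq_fourierMultiplierCLM,
      fourierMultiplierCLM_fourierMultiplierCLM_apply hg₁ hg₂, neg_smul, neg_neg, ← hA₂]
    have := (Lp.toTemperedDistributionCLM ℂ (volume : Measure E) 2).map_smul_of_tower
      ((2 * Real.pi) ^ 2 : ℝ) (A₂ v)
    exact this
  obtain ⟨u, hu⟩ : ∃ u : ℕ → 𝓢(E, ℂ), Tendsto (fun n => (u n).toLp 2 volume) atTop (𝓝 v) := by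
    have hd := SchwartzMap.denseRange_toLpCLM (E := E) (F := ℂ)
      (μ := (volume : Measure E)) (p := 2) (by norm_num)
    have hmem := mem_closure_iff_seq_limit.mp (hd v)
    obtain ⟨s, hs, hlim⟩ := hmem
    choose w hw using hs
    refine ⟨w, ?_⟩
    have : s = fun n => (w n).toLp 2 volume := by
      ext1 n
      exact (hw n).symm
    rwa [← this]
  refine ⟨fun n => SchwartzMap.fourierMultiplierCLM ℂ g₁ (u n), ?_, ?_⟩
  · simp only [← hA₁s]
    rw [← hψv]
    exact (hA₁c.tendsto v).comp hu
  · have : ∀ n, (-Δ (SchwartzMap.fourierMultiplierCLM ℂ g₁ (u n)) : 𝓢(E, ℂ)).toLp 2 volume =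
        ((2 * Real.pi) ^ 2 : ℝ) • A₂ ((u n).toLp 2 volume) := by
      intro n
      have h1 : (-Δ (SchwartzMap.fourierMultiplierCLM ℂ g₁ (u n)) : 𝓢(E, ℂ)) =
          ((2 * Real.pi) ^ 2 : ℝ) • SchwartzMap.fourierMultiplierCLM ℂ (g₁ * g₂) (u n) := by
        rw [SchwartzMap.laplacian_eq_fourierMultiplierCLM, neg_smul, neg_neg]
        congr 1
        rw [mul_comm g₁ g₂, ← SchwartzMap.fourierMultiplierCLM_fourierMultiplierCLM_apply hg₂ hg₁]
        have := SchwartzMap.fourierMultiplierCLM_ofReal (F := ℂ) ℂ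
          (g := fun x : E => ‖x‖ ^ 2) (by fun_prop) (SchwartzMap.fourierMultiplierCLM ℂ g₁ (u n))
        exact this.symm
      rw [h1, hA₂s]
      exact (SchwartzMap.toLpCLM ℝ ℂ 2 (volume : Measure E)).map_smul _ _
    simp only [this]
    rw [← hTv]
    exact (((hA₂c.tendsto v).comp hu).const_smul _)

end Approximation

/-! ### The weighted energy bound -/

section Energy

open Filter Topology LineDeriv

theorem schwartz_hasLineDerivAt {E : Type*} [NormedAddCommGroup E] [NormedSpace ℝ E]
    (f : 𝓢(E, ℂ)) (v x : E) :
    HasLineDerivAt ℝ f ((∂_{v} f : 𝓢(E, ℂ)) x) x v := by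
  rw [SchwartzMap.lineDerivOp_apply]
  exact (f.differentiableAt.lineDifferentiableAt).hasLineDerivAt

variable {E : Type*} [NormedAddCommGroup E] [InnerProductSpace ℝ E] [FiniteDimensional ℝ E]
  [MeasurableSpace E] [BorelSpace E]

/-- Real-valued functions that are continuous and bounded. -/
structure BddCont {X : Type*} [TopologicalSpace X] (w : X → ℝ) : Prop where
  continuous : Continuous w
  bounded : ∃ C, ∀ x, |w x| ≤ C

namespace BddCont

variable {X : Type*} [TopologicalSpace X] {u w : X → ℝ}

theorem of_le (hw : Continuous w) (C : ℝ) (h : ∀ x, |w x| ≤ C) : BddCont w := ⟨hw, C, h⟩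

theorem const (c : ℝ) : BddCont (fun _ : X => c) := ⟨continuous_const, |c|, fun _ => le_rfl⟩

theorem mul (hu : BddCont u) (hw : BddCont w) : BddCont (fun x => u x * w x) := by
  obtain ⟨hu, C, hC⟩ := hu
  obtain ⟨hw, D, hD⟩ := hw
  refine ⟨hu.mul hw, C * D, fun x => ?_⟩
  rw [abs_mul]
  exact mul_le_mul (hC x) (hD x) (abs_nonneg _) ((abs_nonneg _).trans (hC x))

theorem add (hu : BddCont u) (hw : BddCont w) : BddCont (fun x => u x + w x) := by
  obtain ⟨hu, C, hC⟩ := hu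
  obtain ⟨hw, D, hD⟩ := hw
  exact ⟨hu.add hw, C + D, fun x => (abs_add_le _ _).trans (add_le_add (hC x) (hD x))⟩

theorem sub (hu : BddCont u) (hw : BddCont w) : BddCont (fun x => u x - w x) := by
  simpa [sub_eq_add_neg] using hu.add ((const (-1)).mul hw)

theorem sq (hu : BddCont u) : BddCont (fun x => u x ^ 2) := by
  simpa [pow_two] using hu.mul hu

theorem sum {ι : Type*} (s : Finset ι) {u : ι → X → ℝ} (hu : ∀ i ∈ s, BddCont (u i)) :
    BddCont (fun x => ∑ i ∈ s, u i x) := by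
  classical
  induction s using Finset.induction_on with
  | empty => simpa using const 0
  | insert a s ha ih =>
    simp only [Finset.sum_insert ha]
    exact (hu a (by simp)).add (ih fun i hi => hu i (by simp [hi]))

theorem exp_two_mul (hw : BddCont w) : BddCont (fun x => Real.exp (2 * w x)) := by
  obtain ⟨hc, C, hC⟩ := hw
  refine of_le (Real.continuous_exp.comp (continuous_const.mul hc)) (Real.exp (2 * C))
    fun x => ?_
  rw [abs_of_pos (Real.exp_pos _), Real.exp_le_exp]
  linarith [(abs_le.mp (hC x)).2]

end BddCont

theorem integrable_inner_of_memLp {u w : E → ℂ} (hu : MemLp u 2 volume) (hw : MemLp w 2 volume) :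
    Integrable (fun x => inner ℝ (u x) (w x)) volume := by
  have h := L2.integrable_inner (𝕜 := ℝ) (hu.toLp u) (hw.toLp w)
  refine h.congr ?_
  filter_upwards [hu.coeFn_toLp, hw.coeFn_toLp] with x h1 h2
  rw [h1, h2]

theorem BddCont.integrable_mul {B h : E → ℝ} (hB : BddCont B) (hh : Integrable h volume) :
    Integrable (fun x => B x * h x) volume := by
  obtain ⟨hc, C, hC⟩ := hB
  exact hh.bdd_mul hc.aestronglyMeasurable (ae_of_all _ hC)

/-- Integration by parts against the constant function `1`. -/
theorem integral_lineDeriv_eq_zero {h h' : E → ℝ} {v : E} (hh : Integrable h volume)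
    (hh' : Integrable h' volume) (hd : ∀ x, HasLineDerivAt ℝ h (h' x) x v) :
    ∫ x, h' x = 0 := by
  have := integral_bilinear_hasLineDerivAt_right_eq_neg_left_of_integrable
    (μ := (volume : Measure E)) (f := fun _ => (1 : ℝ)) (f' := fun _ => 0) (g := h) (g' := h')
    (v := v) (B := ContinuousLinearMap.mul ℝ ℝ) (by simp) (by simpa using hh')
    (by simpa using hh) (fun x _ => by
      simpa using (hasFDerivAt_const (1 : ℝ) x).hasLineDerivAt v) (fun x _ => hd x)
  simpa using this

/-- Integration by parts with the weight `W = e^{2G}`, where `g` is the derivative of `G` in the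
direction `v`, followed by completing the square in `∂ᵥ f + (g + z) f`. -/
theorem directional_energy_bound (f : 𝓢(E, ℂ)) (v : E) {W g z dz : E → ℝ}
    (hW₀ : ∀ x, 0 ≤ W x) (hW : BddCont W) (hg : BddCont g) (hz : BddCont z) (hdz : BddCont dz)
    (hWd : ∀ x, HasLineDerivAt ℝ W (2 * W x * g x) x v)
    (hzd : ∀ x, HasLineDerivAt ℝ z (dz x) x v) :
    ∫ x, W x * (dz x - z x ^ 2 - g x ^ 2) * ‖f x‖ ^ 2 ≤
      ∫ x, W x * inner ℝ (f x) (-(∂_{v} (∂_{v} f) : 𝓢(E, ℂ)) x) := by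
  set f₁ : 𝓢(E, ℂ) := ∂_{v} f with hf₁
  set f₂ : 𝓢(E, ℂ) := ∂_{v} f₁ with hf₂
  have hm := f.memLp 2 (volume : Measure E)
  have hm₁ := f₁.memLp 2 (volume : Measure E)
  have hm₂ := f₂.memLp 2 (volume : Measure E)
  have i00 : Integrable (fun x => ‖f x‖ ^ 2) := by
    simpa using integrable_inner_of_memLp hm hm
  have i11 : Integrable (fun x => ‖f₁ x‖ ^ 2) := by
    simpa using integrable_inner_of_memLp hm₁ hm₁
  have i01 := integrable_inner_of_memLp hm hm₁
  have i02 := integrable_inner_of_memLp hm hm₂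
  -- the integrand is the derivative of `W (Re (f̄ ∂ᵥ f) + z |f|²)`
  have hzero : ∫ x, (2 * W x * g x * (inner ℝ (f x) (f₁ x) + z x * ‖f x‖ ^ 2) +
      W x * (‖f₁ x‖ ^ 2 + inner ℝ (f x) (f₂ x) + dz x * ‖f x‖ ^ 2 +
        2 * z x * inner ℝ (f x) (f₁ x))) = 0 := by
    refine integral_lineDeriv_eq_zero (v := v)
      (h := fun x => W x * (inner ℝ (f x) (f₁ x) + z x * ‖f x‖ ^ 2)) ?_ ?_ ?_
    · exact hW.integrable_mul (i01.add (hz.integrable_mul i00))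
    · refine Integrable.add ?_ (hW.integrable_mul (((i11.add i02).add
        (hdz.integrable_mul i00)).add (((BddCont.const 2).mul hz).integrable_mul i01)))
      exact (((BddCont.const 2).mul hW).mul hg).integrable_mul (i01.add (hz.integrable_mul i00))
    · intro x
      have a := hWd x
      have b := hzd x
      have c := schwartz_hasLineDerivAt f v x
      have d := schwartz_hasLineDerivAt f₁ v x
      simp only [HasLineDerivAt, ← hf₁, ← hf₂] at a b c d ⊢
      have e := a.mul ((c.inner ℝ d).add (b.mul c.norm_sq))
      convert! e using 1
      simp only [zero_smul, add_zero, real_inner_self_eq_norm_sq, Pi.add_apply, Pi.mul_apply]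
      ring
  -- the difference of the two sides is `W |∂ᵥ f + (g + z) f|²`
  have key : ∀ x, W x * (dz x - z x ^ 2 - g x ^ 2) * ‖f x‖ ^ 2 -
      W x * inner ℝ (f x) (-f₂ x) ≤
      (2 * W x * g x * (inner ℝ (f x) (f₁ x) + z x * ‖f x‖ ^ 2) +
      W x * (‖f₁ x‖ ^ 2 + inner ℝ (f x) (f₂ x) + dz x * ‖f x‖ ^ 2 +
        2 * z x * inner ℝ (f x) (f₁ x))) := by
    intro x
    have h1 : 0 ≤ ‖f₁ x + (g x + z x) • f x‖ ^ 2 := by positivity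
    rw [norm_add_sq_real, inner_smul_right, norm_smul, mul_pow, Real.norm_eq_abs, sq_abs,
      real_inner_comm] at h1
    rw [inner_neg_right]
    have h2 := mul_nonneg (hW₀ x) h1
    linarith
  have hint := integral_mono (μ := (volume : Measure E))
    (f := fun x => W x * (dz x - z x ^ 2 - g x ^ 2) * ‖f x‖ ^ 2 - W x * inner ℝ (f x) (-f₂ x))
    ?_ ?_ key
  · rw [hzero, integral_sub] at hint
    · simpa using hint
    · exact (hW.mul ((hdz.sub hz.sq).sub hg.sq)).integrable_mul i00
    · refine hW.integrable_mul ?_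
      simp only [inner_neg_right]
      exact i02.neg
  · refine ((hW.mul ((hdz.sub hz.sq).sub hg.sq)).integrable_mul i00).sub (hW.integrable_mul ?_)
    simp only [inner_neg_right]
    exact i02.neg
  · refine Integrable.add ?_ (hW.integrable_mul (((i11.add i02).add
        (hdz.integrable_mul i00)).add (((BddCont.const 2).mul hz).integrable_mul i01)))
    exact (((BddCont.const 2).mul hW).mul hg).integrable_mul (i01.add (hz.integrable_mul i00))

variable {ι : Type*} [Fintype ι]

/-- The sum of the directional bounds over an orthonormal basis: here `z` is a vector field with
`dz i = ∂ᵢ zᵢ`, and `g` is the gradient of `G`, where `W = e^{2G}`. -/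
theorem schwartz_energy_bound (b : OrthonormalBasis ι ℝ E) (f : 𝓢(E, ℂ)) {W : E → ℝ}
    {g z dz : ι → E → ℝ}
    (hW₀ : ∀ x, 0 ≤ W x) (hW : BddCont W) (hg : ∀ i, BddCont (g i)) (hz : ∀ i, BddCont (z i))
    (hdz : ∀ i, BddCont (dz i))
    (hWd : ∀ i x, HasLineDerivAt ℝ W (2 * W x * g i x) x (b i))
    (hzd : ∀ i x, HasLineDerivAt ℝ (z i) (dz i x) x (b i)) :
    ∫ x, W x * (∑ i, (dz i x - z i x ^ 2 - g i x ^ 2)) * ‖f x‖ ^ 2 ≤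
      ∫ x, W x * inner ℝ (f x) ((-Δ f : 𝓢(E, ℂ)) x) := by
  have i00 : Integrable (fun x => ‖f x‖ ^ 2) := by
    simpa using integrable_inner_of_memLp (f.memLp 2 (volume : Measure E))
      (f.memLp 2 (volume : Measure E))
  have h1 : ∀ x, W x * (∑ i, (dz i x - z i x ^ 2 - g i x ^ 2)) * ‖f x‖ ^ 2 =
      ∑ i, W x * (dz i x - z i x ^ 2 - g i x ^ 2) * ‖f x‖ ^ 2 := by
    intro x
    rw [Finset.mul_sum, Finset.sum_mul]
  have h2 : ∀ x, W x * inner ℝ (f x) ((-Δ f : 𝓢(E, ℂ)) x) =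
      ∑ i, W x * inner ℝ (f x) (-(∂_{b i} (∂_{b i} f) : 𝓢(E, ℂ)) x) := by
    intro x
    rw [SchwartzMap.laplacian_eq_sum b, ← Finset.mul_sum, ← inner_sum]
    simp
  simp only [h1, h2]
  rw [integral_finsetSum, integral_finsetSum]
  · exact Finset.sum_le_sum fun i _ =>
      directional_energy_bound f (b i) hW₀ hW (hg i) (hz i) (hdz i) (hWd i) (hzd i)
  · intro i _
    refine hW.integrable_mul ?_
    have := (integrable_inner_of_memLp (f.memLp 2 (volume : Measure E))
      ((∂_{b i} (∂_{b i} f) : 𝓢(E, ℂ)).memLp 2 (volume : Measure E)))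
    simp only [inner_neg_right]
    exact this.neg
  · intro i _
    exact (hW.mul (((hdz i).sub (hz i).sq).sub (hg i).sq)).integrable_mul i00

theorem tendsto_integral_mul_inner {B : E → ℝ} (hB : BddCont B) {u w : ℕ → Lp ℂ 2 (volume : Measure E)}
    {u₀ w₀ : Lp ℂ 2 (volume : Measure E)} (hu : Tendsto u atTop (𝓝 u₀))
    (hw : Tendsto w atTop (𝓝 w₀)) :
    Tendsto (fun n => ∫ x, B x * inner ℝ (u n x) (w n x)) atTop
      (𝓝 (∫ x, B x * inner ℝ (u₀ x) (w₀ x))) := by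
  obtain ⟨hc, C, hC⟩ := hB
  have hmem : MemLp (fun x => (B x : ℂ)) ∞ (volume : Measure E) :=
    memLp_top_of_bound (Complex.continuous_ofReal.comp hc).aestronglyMeasurable C
      (ae_of_all _ fun x => by simpa using hC x)
  have key : ∀ u w : Lp ℂ 2 (volume : Measure E), ∫ x, B x * inner ℝ (u x) (w x) =
      inner ℝ u (hmem.toLp _ • w : Lp ℂ 2 (volume : Measure E)) := by
    intro u w
    rw [L2.inner_def]
    refine integral_congr_ae ?_
    filter_upwards [Lp.coeFn_lpSMul (r := 2) (hmem.toLp _) w, hmem.coeFn_toLp] with x h1 h2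
    rw [h1, Pi.smul_apply', h2, smul_eq_mul, ← Complex.real_smul, inner_smul_right]
  simp only [key]
  refine hu.inner (Tendsto.comp (y := 𝓝 w₀) ?_ hw)
  exact (continuous_Linfty_smul _).tendsto w₀

/-- The weighted energy bound for `ψ ∈ H²` with `T = -Δ ψ`:
`∫ W (div z - |z|² - |∇G|²) |ψ|² ≤ ∫ W Re (ψ̄ T)`. -/
theorem sobolev_energy_bound (b : OrthonormalBasis ι ℝ E) {ψ T : Lp ℂ 2 (volume : Measure E)}
    (hψ : TemperedDistribution.MemSobolev 2 2 (ψ : 𝓢'(E, ℂ)))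
    (hT : (T : 𝓢'(E, ℂ)) = -Δ (ψ : 𝓢'(E, ℂ))) {W : E → ℝ} {g z dz : ι → E → ℝ}
    (hW₀ : ∀ x, 0 ≤ W x) (hW : BddCont W) (hg : ∀ i, BddCont (g i)) (hz : ∀ i, BddCont (z i))
    (hdz : ∀ i, BddCont (dz i))
    (hWd : ∀ i x, HasLineDerivAt ℝ W (2 * W x * g i x) x (b i))
    (hzd : ∀ i x, HasLineDerivAt ℝ (z i) (dz i x) x (b i)) :
    ∫ x, W x * (∑ i, (dz i x - z i x ^ 2 - g i x ^ 2)) * ‖ψ x‖ ^ 2 ≤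
      ∫ x, W x * inner ℝ (ψ x) (T x) := by
  obtain ⟨f, hf, hf'⟩ := exists_schwartz_tendsto hψ hT
  have hB : BddCont (fun x => W x * (∑ i, (dz i x - z i x ^ 2 - g i x ^ 2))) :=
    hW.mul (BddCont.sum _ fun i _ => ((hdz i).sub (hz i).sq).sub (hg i).sq)
  have t1 := tendsto_integral_mul_inner hB hf hf
  have t2 := tendsto_integral_mul_inner hW hf hf'
  simp only [real_inner_self_eq_norm_sq] at t1
  refine le_of_tendsto_of_tendsto' t1 t2 fun n => ?_
  have h := schwartz_energy_bound b (f n) hW₀ hW hg hz hdz hWd hzd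
  have e1 := (f n).coeFn_toLp 2 (volume : Measure E)
  have e2 := (-Δ (f n) : 𝓢(E, ℂ)).coeFn_toLp 2 (volume : Measure E)
  refine le_of_eq_of_le (integral_congr_ae ?_) (h.trans_eq (integral_congr_ae ?_))
  · filter_upwards [e1] with x hx
    rw [hx]
  · filter_upwards [e1, e2] with x hx hx'
    rw [hx, hx']

end Energy

/-! ### Radial vector fields on `ℝ³ × ℝ³` -/

open Filter Topology

/-- The standard orthonormal basis of `ℝ³ × ℝ³`. -/
noncomputable def configBasis : OrthonormalBasis (Fin 3 ⊕ Fin 3) ℝ Config :=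
  (EuclideanSpace.basisFun (Fin 3) ℝ).prod (EuclideanSpace.basisFun (Fin 3) ℝ)

theorem configBasis_inl (j : Fin 3) :
    configBasis (Sum.inl j) = WithLp.toLp 2 (EuclideanSpace.single j (1 : ℝ), 0) := by
  simp [configBasis, OrthonormalBasis.prod_apply]

theorem configBasis_inr (j : Fin 3) :
    configBasis (Sum.inr j) = WithLp.toLp 2 (0, EuclideanSpace.single j (1 : ℝ)) := by
  simp [configBasis, OrthonormalBasis.prod_apply]

theorem continuous_fst_config : Continuous fun x : Config => x.fst :=
  (WithLp.fstL 2 ℝ (EuclideanSpace ℝ (Fin 3)) (EuclideanSpace ℝ (Fin 3))).continuous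

theorem continuous_snd_config : Continuous fun x : Config => x.snd :=
  (WithLp.sndL 2 ℝ (EuclideanSpace ℝ (Fin 3)) (EuclideanSpace ℝ (Fin 3))).continuous

theorem hasDerivAt_coord_line (v : EuclideanSpace ℝ (Fin 3)) (j : Fin 3) :
    HasDerivAt (fun t : ℝ => (v + t • EuclideanSpace.single j (1 : ℝ)) j) 1 0 := by
  simpa using (hasDerivAt_id (0 : ℝ)).const_add (v j)

theorem hasDerivAt_norm_sq_line (v : EuclideanSpace ℝ (Fin 3)) (j : Fin 3) :
    HasDerivAt (fun t : ℝ => ‖v + t • EuclideanSpace.single j (1 : ℝ)‖ ^ 2) (2 * v j) 0 := by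
  have h : HasDerivAt (fun t : ℝ => v + t • EuclideanSpace.single j (1 : ℝ))
      (EuclideanSpace.single j (1 : ℝ)) 0 := by
    simpa using ((hasDerivAt_id (0 : ℝ)).smul_const (EuclideanSpace.single j (1 : ℝ))).const_add v
  convert! h.norm_sq using 1
  simp [EuclideanSpace.inner_single_right]

/-- If `Φ` depends on `x` through `|x₁|²` and `|x₂|²` only, its derivative along the `j`-th
coordinate of `x₁` is `2 (x₁)ⱼ` times the partial derivative. -/
theorem hasLineDerivAt_inl {φ : ℝ → ℝ} {φ' : ℝ} {Φ : Config → ℝ} (x : Config) (j : Fin 3)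
    (hφ : HasDerivAt φ φ' (‖x.fst‖ ^ 2))
    (hΦ : ∀ y : Config, y.snd = x.snd → Φ y = φ (‖y.fst‖ ^ 2)) :
    HasLineDerivAt ℝ Φ (2 * x.fst j * φ') x (configBasis (Sum.inl j)) := by
  have h1 := hasDerivAt_norm_sq_line x.fst j
  have h2 : HasDerivAt φ φ' (‖x.fst + (0 : ℝ) • EuclideanSpace.single j (1 : ℝ)‖ ^ 2) := by
    simpa using hφ
  have h3 := HasDerivAt.comp (0 : ℝ) h2 h1
  rw [mul_comm] at h3
  refine h3.congr_of_eventuallyEq (Eventually.of_forall fun t => ?_)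
  rw [configBasis_inl]
  simp [hΦ]

theorem hasLineDerivAt_inr {φ : ℝ → ℝ} {φ' : ℝ} {Φ : Config → ℝ} (x : Config) (j : Fin 3)
    (hφ : HasDerivAt φ φ' (‖x.snd‖ ^ 2))
    (hΦ : ∀ y : Config, y.fst = x.fst → Φ y = φ (‖y.snd‖ ^ 2)) :
    HasLineDerivAt ℝ Φ (2 * x.snd j * φ') x (configBasis (Sum.inr j)) := by
  have h1 := hasDerivAt_norm_sq_line x.snd j
  have h2 : HasDerivAt φ φ' (‖x.snd + (0 : ℝ) • EuclideanSpace.single j (1 : ℝ)‖ ^ 2) := by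
    simpa using hφ
  have h3 := HasDerivAt.comp (0 : ℝ) h2 h1
  rw [mul_comm] at h3
  refine h3.congr_of_eventuallyEq (Eventually.of_forall fun t => ?_)
  rw [configBasis_inr]
  simp [hΦ]

theorem sum_coord_sq (v : EuclideanSpace ℝ (Fin 3)) : ∑ j, v j ^ 2 = ‖v‖ ^ 2 := by
  simp [EuclideanSpace.norm_sq_eq]

/-- The vector field on `ℝ⁶` whose two blocks are `q(|x₂|², |x₁|²) x₁` and
`q(|x₁|², |x₂|²) x₂`. -/
noncomputable def radialField (q : ℝ → ℝ → ℝ) : Fin 3 ⊕ Fin 3 → Config → ℝ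
  | Sum.inl j, x => x.fst j * q (‖x.snd‖ ^ 2) (‖x.fst‖ ^ 2)
  | Sum.inr j, x => x.snd j * q (‖x.fst‖ ^ 2) (‖x.snd‖ ^ 2)

/-- The diagonal entries `∂ᵢ zᵢ` of the Jacobian of `radialField q`, where `q'` is the derivative of
`q` in its second argument. -/
noncomputable def radialFieldDeriv (q q' : ℝ → ℝ → ℝ) : Fin 3 ⊕ Fin 3 → Config → ℝ
  | Sum.inl j, x => q (‖x.snd‖ ^ 2) (‖x.fst‖ ^ 2) +
      2 * x.fst j ^ 2 * q' (‖x.snd‖ ^ 2) (‖x.fst‖ ^ 2)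
  | Sum.inr j, x => q (‖x.fst‖ ^ 2) (‖x.snd‖ ^ 2) +
      2 * x.snd j ^ 2 * q' (‖x.fst‖ ^ 2) (‖x.snd‖ ^ 2)

/-- The contribution `div z - |z|²` of one block of `radialField q`. -/
def blockEnergy (q q' : ℝ → ℝ → ℝ) (m s : ℝ) : ℝ := 3 * q m s + 2 * s * q' m s - s * q m s ^ 2

/-- Regularity and boundedness of a radial profile `q` with derivative `q'`, as needed to integrate
by parts against `radialField q`. -/
structure IsProfile (q q' : ℝ → ℝ → ℝ) : Prop where
  hasDerivAt : ∀ m s, 0 ≤ m → 0 ≤ s → HasDerivAt (q m) (q' m s) s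
  continuous : Continuous fun p : ℝ × ℝ => q (p.1 ^ 2) (p.2 ^ 2)
  continuous_deriv : Continuous fun p : ℝ × ℝ => q' (p.1 ^ 2) (p.2 ^ 2)
  bounded : ∃ C, ∀ m s, 0 ≤ m → 0 ≤ s → |q m s| ≤ C ∧ s * q m s ^ 2 ≤ C ∧ s * |q' m s| ≤ C

theorem coord_sq_le (v : EuclideanSpace ℝ (Fin 3)) (j : Fin 3) : v j ^ 2 ≤ ‖v‖ ^ 2 := by
  rw [← sum_coord_sq]
  exact Finset.single_le_sum (f := fun j => v j ^ 2) (fun i _ => sq_nonneg _) (Finset.mem_univ j)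

namespace IsProfile

variable {q q' : ℝ → ℝ → ℝ}

theorem bddCont_block (h : IsProfile q q') {u v : Config → EuclideanSpace ℝ (Fin 3)}
    (hu : Continuous u) (hv : Continuous v) (j : Fin 3) :
    BddCont (fun x => v x j * q (‖u x‖ ^ 2) (‖v x‖ ^ 2)) ∧
    BddCont (fun x => q (‖u x‖ ^ 2) (‖v x‖ ^ 2) + 2 * v x j ^ 2 * q' (‖u x‖ ^ 2) (‖v x‖ ^ 2)) := by
  obtain ⟨C, hC⟩ := h.bounded
  have c1 : Continuous fun x => q (‖u x‖ ^ 2) (‖v x‖ ^ 2) :=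
    h.continuous.comp (hu.norm.prodMk hv.norm)
  have c2 : Continuous fun x => q' (‖u x‖ ^ 2) (‖v x‖ ^ 2) :=
    h.continuous_deriv.comp (hu.norm.prodMk hv.norm)
  have c3 : Continuous fun x => v x j := by fun_prop
  refine ⟨.of_le (c3.mul c1) (1 + C) fun x => ?_,
    .of_le (c1.add ((continuous_const.mul (c3.pow 2)).mul c2)) (C + 2 * C) fun x => ?_⟩
  · obtain ⟨-, h2, -⟩ := hC (‖u x‖ ^ 2) (‖v x‖ ^ 2) (by positivity) (by positivity)
    have h3 : (v x j * q (‖u x‖ ^ 2) (‖v x‖ ^ 2)) ^ 2 ≤ C := by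
      rw [mul_pow]
      exact (mul_le_mul_of_nonneg_right (coord_sq_le _ _) (sq_nonneg _)).trans h2
    rw [abs_le]
    constructor <;> nlinarith
  · obtain ⟨h1, -, h2⟩ := hC (‖u x‖ ^ 2) (‖v x‖ ^ 2) (by positivity) (by positivity)
    refine (abs_add_le _ _).trans (add_le_add h1 ?_)
    rw [abs_mul, abs_of_nonneg (by positivity : 0 ≤ 2 * v x j ^ 2), mul_assoc]
    refine mul_le_mul_of_nonneg_left (le_trans ?_ h2) zero_le_two
    exact mul_le_mul_of_nonneg_right (coord_sq_le _ _) (abs_nonneg _)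

theorem bddCont_field (h : IsProfile q q') : ∀ i, BddCont (radialField q i)
  | Sum.inl j => (h.bddCont_block continuous_snd_config continuous_fst_config j).1
  | Sum.inr j => (h.bddCont_block continuous_fst_config continuous_snd_config j).1

theorem bddCont_fieldDeriv (h : IsProfile q q') : ∀ i, BddCont (radialFieldDeriv q q' i)
  | Sum.inl j => (h.bddCont_block continuous_snd_config continuous_fst_config j).2
  | Sum.inr j => (h.bddCont_block continuous_fst_config continuous_snd_config j).2

theorem hasLineDerivAt_field (h : IsProfile q q') : ∀ i x,
    HasLineDerivAt ℝ (radialField q i) (radialFieldDeriv q q' i x) x (configBasis i)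
  | Sum.inl j, x => by
    have h1 := hasLineDerivAt_inl (Φ := fun y => q (‖y.snd‖ ^ 2) (‖y.fst‖ ^ 2)) x j
      (h.hasDerivAt (‖x.snd‖ ^ 2) (‖x.fst‖ ^ 2) (by positivity) (by positivity))
      (fun y hy => by rw [hy])
    have h2 : HasLineDerivAt ℝ (fun y : Config => y.fst j) 1 x (configBasis (Sum.inl j)) := by
      refine (hasDerivAt_coord_line x.fst j).congr_of_eventuallyEq
        (Eventually.of_forall fun t => ?_)
      rw [configBasis_inl]
      simp
    simp only [HasLineDerivAt] at h1 h2 ⊢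
    convert! h2.mul h1 using 1
    simp only [radialFieldDeriv, zero_smul, add_zero]
    ring
  | Sum.inr j, x => by
    have h1 := hasLineDerivAt_inr (Φ := fun y => q (‖y.fst‖ ^ 2) (‖y.snd‖ ^ 2)) x j
      (h.hasDerivAt (‖x.fst‖ ^ 2) (‖x.snd‖ ^ 2) (by positivity) (by positivity))
      (fun y hy => by rw [hy])
    have h2 : HasLineDerivAt ℝ (fun y : Config => y.snd j) 1 x (configBasis (Sum.inr j)) := by
      refine (hasDerivAt_coord_line x.snd j).congr_of_eventuallyEq
        (Eventually.of_forall fun t => ?_)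
      rw [configBasis_inr]
      simp
    simp only [HasLineDerivAt] at h1 h2 ⊢
    convert! h2.mul h1 using 1
    simp only [radialFieldDeriv, zero_smul, add_zero]
    ring

end IsProfile

theorem sum_radialField (q q' : ℝ → ℝ → ℝ) (x : Config) :
    ∑ i, (radialFieldDeriv q q' i x - radialField q i x ^ 2) =
      blockEnergy q q' (‖x.snd‖ ^ 2) (‖x.fst‖ ^ 2) +
        blockEnergy q q' (‖x.fst‖ ^ 2) (‖x.snd‖ ^ 2) := by
  rw [Fintype.sum_sum_type]
  simp only [radialField, radialFieldDeriv, blockEnergy, ← sum_coord_sq, Fin.sum_univ_three]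
  ring

theorem integrable_norm_sq (ψ : StateSpace) : Integrable fun x => ‖ψ x‖ ^ 2 := by
  simpa using integrable_inner_of_memLp (Lp.memLp ψ) (Lp.memLp ψ)

/-- The eigenvalue equation, tested pointwise against `ψ`; here `T = -Δ ψ`. -/
theorem inner_eq_of_eigenvalue {U : ℝ} {ψ T : StateSpace}
    (h : ∀ᵐ x : Config, ((-(1 / 4) : ℂ) • ψ) x = T x + (potential U x : ℂ) * ψ x) :
    ∀ᵐ x : Config, inner ℝ (ψ x) (T x) = -((1 / 4 + potential U x) * ‖ψ x‖ ^ 2) := by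
  filter_upwards [h, Lp.coeFn_smul (-(1 / 4) : ℂ) ψ] with x h1 h2
  have h3 : T x = (-(1 / 4) - potential U x : ℝ) • ψ x := by
    rw [h2, Pi.smul_apply, smul_eq_mul] at h1
    rw [Complex.real_smul]
    push_cast
    linear_combination -h1
  rw [h3, inner_smul_right, real_inner_self_eq_norm_sq]
  ring

/-- For a solution of `H_U ψ = -ψ/4`, a bounded weight `e^{2G}` and any admissible radial field `z`,
`∫ e^{2G} (1/4 + V + div z - |z|² - |∇G|²) |ψ|² ≤ 0`. -/
theorem weighted_energy_le_zero {U : ℝ} {ψ : StateSpace}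
    (hψ : IsHamiltonianImage U ψ ((-(1 / 4) : ℂ) • ψ)) {G : Config → ℝ}
    {g : Fin 3 ⊕ Fin 3 → Config → ℝ} (hG : BddCont G) (hg : ∀ i, BddCont (g i))
    (hGd : ∀ i x, HasLineDerivAt ℝ G (g i x) x (configBasis i))
    {q q' : ℝ → ℝ → ℝ} (hq : IsProfile q q') :
    Integrable (fun x => Real.exp (2 * G x) * (1 / 4 + potential U x +
      (blockEnergy q q' (‖x.snd‖ ^ 2) (‖x.fst‖ ^ 2) +
        blockEnergy q q' (‖x.fst‖ ^ 2) (‖x.snd‖ ^ 2)) - ∑ i, g i x ^ 2) * ‖ψ x‖ ^ 2) ∧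
    ∫ x, Real.exp (2 * G x) * (1 / 4 + potential U x +
      (blockEnergy q q' (‖x.snd‖ ^ 2) (‖x.fst‖ ^ 2) +
        blockEnergy q q' (‖x.fst‖ ^ 2) (‖x.snd‖ ^ 2)) - ∑ i, g i x ^ 2) * ‖ψ x‖ ^ 2 ≤ 0 := by
  obtain ⟨hsob, T, hT, heq⟩ := hψ
  have hW : BddCont fun x => Real.exp (2 * G x) := hG.exp_two_mul
  have hbound := sobolev_energy_bound configBasis hsob hT (fun x => (Real.exp_pos _).le) hW hg
    hq.bddCont_field hq.bddCont_fieldDeriv (fun i x => by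
      have h := hGd i x
      simp only [HasLineDerivAt] at h ⊢
      convert! (h.const_mul 2).exp using 1
      simp only [zero_smul, add_zero]
      ring) hq.hasLineDerivAt_field
  have i1 := integrable_norm_sq ψ
  have i2 : Integrable fun x => Real.exp (2 * G x) * inner ℝ (ψ x) (T x) :=
    hW.integrable_mul (integrable_inner_of_memLp (Lp.memLp ψ) (Lp.memLp T))
  have i3 : Integrable fun x => Real.exp (2 * G x) *
      (∑ i, (radialFieldDeriv q q' i x - radialField q i x ^ 2 - g i x ^ 2)) * ‖ψ x‖ ^ 2 :=
    (hW.mul (BddCont.sum _ fun i _ => ((hq.bddCont_fieldDeriv i).sub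
      (hq.bddCont_field i).sq).sub (hg i).sq)).integrable_mul i1
  have hae : (fun x => Real.exp (2 * G x) *
      (∑ i, (radialFieldDeriv q q' i x - radialField q i x ^ 2 - g i x ^ 2)) * ‖ψ x‖ ^ 2 -
      Real.exp (2 * G x) * inner ℝ (ψ x) (T x)) =ᵐ[volume]
      fun x => Real.exp (2 * G x) * (1 / 4 + potential U x +
      (blockEnergy q q' (‖x.snd‖ ^ 2) (‖x.fst‖ ^ 2) +
        blockEnergy q q' (‖x.fst‖ ^ 2) (‖x.snd‖ ^ 2)) - ∑ i, g i x ^ 2) * ‖ψ x‖ ^ 2 := by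
    filter_upwards [inner_eq_of_eigenvalue heq] with x h1
    rw [h1, Finset.sum_sub_distrib, sum_radialField]
    ring
  refine ⟨(i3.sub i2).congr hae, ?_⟩
  rw [← integral_congr_ae hae, integral_sub i3 i2]
  linarith

/-! ### Regularized Coulomb fields -/

/-- A factor `c(m, s) ∈ [0, 1]`, differentiable in `s` with derivative `c'`. -/
structure IsCutoff (c c' : ℝ → ℝ → ℝ) : Prop where
  hasDerivAt : ∀ m s, 0 ≤ m → 0 ≤ s → HasDerivAt (c m) (c' m s) s
  continuous : Continuous fun p : ℝ × ℝ => c (p.1 ^ 2) (p.2 ^ 2)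
  continuous_deriv : Continuous fun p : ℝ × ℝ => c' (p.1 ^ 2) (p.2 ^ 2)
  nonneg : ∀ m s, 0 ≤ m → 0 ≤ s → 0 ≤ c m s
  le_one : ∀ m s, 0 ≤ m → 0 ≤ s → c m s ≤ 1
  bounded : ∃ C, ∀ m s, 0 ≤ m → 0 ≤ s → s * |c' m s| ≤ C

/-- The profile `c / √(ε² + s)`, a regularization of the field `c x / |x|`. -/
noncomputable def regProfile (c : ℝ → ℝ → ℝ) (ε m s : ℝ) : ℝ := c m s / √(ε ^ 2 + s)

/-- The derivative of `regProfile c ε m s` in `s`. -/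
noncomputable def regProfileDeriv (c c' : ℝ → ℝ → ℝ) (ε m s : ℝ) : ℝ :=
  c' m s / √(ε ^ 2 + s) - c m s / (2 * (ε ^ 2 + s) * √(ε ^ 2 + s))

theorem le_sqrt_sq_add {ε s : ℝ} (hs : 0 ≤ s) : ε ≤ √(ε ^ 2 + s) :=
  Real.le_sqrt_of_sq_le (by linarith)

theorem isProfile_regProfile {c c' : ℝ → ℝ → ℝ} (h : IsCutoff c c') {ε : ℝ} (hε : 0 < ε) :
    IsProfile (regProfile c ε) (regProfileDeriv c c' ε) where
  hasDerivAt m s hm hs := by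
    have hpos : 0 < ε ^ 2 + s := by positivity
    have hr : 0 < √(ε ^ 2 + s) := Real.sqrt_pos.mpr hpos
    have h1 : HasDerivAt (fun s => √(ε ^ 2 + s)) (1 / (2 * √(ε ^ 2 + s))) s :=
      ((hasDerivAt_id s).const_add _).sqrt hpos.ne'
    convert! (h.hasDerivAt m s hm hs).div h1 hr.ne' using 1
    rw [regProfileDeriv, Real.sq_sqrt hpos.le]
    field_simp
    rw [Real.sq_sqrt hpos.le]
  continuous := by
    refine h.continuous.div (by fun_prop) fun p => ?_
    have : 0 < ε ^ 2 + p.2 ^ 2 := by positivity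
    positivity
  continuous_deriv := by
    refine (h.continuous_deriv.div (by fun_prop) fun p => ?_).sub
      (h.continuous.div (by fun_prop) fun p => ?_)
    all_goals
      have : 0 < ε ^ 2 + p.2 ^ 2 := by positivity
      positivity
  bounded := by
    obtain ⟨C, hC⟩ := h.bounded
    have hC0 : 0 ≤ C := le_trans (by simp) (hC 0 0 le_rfl le_rfl)
    refine ⟨1 / ε + 1 + (C / ε + 1 / ε), fun m s hm hs => ?_⟩
    have hle := le_sqrt_sq_add (ε := ε) hs
    have hpos : 0 < ε ^ 2 + s := by positivity
    have hr : 0 < √(ε ^ 2 + s) := Real.sqrt_pos.mpr hpos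
    have c0 := h.nonneg m s hm hs
    have c1 := h.le_one m s hm hs
    have e1 : 0 < 1 / ε := by positivity
    have e2 : 0 ≤ C / ε := by positivity
    refine ⟨?_, ?_, ?_⟩
    · have : |regProfile c ε m s| ≤ 1 / ε := by
        rw [regProfile, abs_of_nonneg (by positivity)]
        gcongr
      linarith
    · have : s * regProfile c ε m s ^ 2 ≤ 1 := by
        rw [regProfile, div_pow, Real.sq_sqrt hpos.le, ← mul_div_assoc, div_le_one hpos]
        nlinarith [mul_le_of_le_one_right hs (pow_le_one₀ c0 c1 : c m s ^ 2 ≤ 1), sq_nonneg ε]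
      linarith
    · have h1 : s * |c' m s / √(ε ^ 2 + s)| ≤ C / ε := by
        rw [abs_div, abs_of_pos hr, ← mul_div_assoc]
        exact div_le_div₀ hC0 (hC m s hm hs) hε hle
      have h2 : s * |c m s / (2 * (ε ^ 2 + s) * √(ε ^ 2 + s))| ≤ 1 / ε := by
        rw [abs_of_nonneg (by positivity), ← mul_div_assoc,
          div_le_div_iff₀ (by positivity) hε]
        have : s * c m s ≤ 2 * (ε ^ 2 + s) := by nlinarith [sq_nonneg ε]
        have h3 : 0 ≤ s * c m s := by positivity
        calc s * c m s * ε ≤ 2 * (ε ^ 2 + s) * √(ε ^ 2 + s) :=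
              mul_le_mul this hle hε.le (by positivity)
          _ = _ := by ring
      have h3 : s * |regProfileDeriv c c' ε m s| ≤ C / ε + 1 / ε := by
        rw [regProfileDeriv]
        calc _ ≤ s * (|c' m s / √(ε ^ 2 + s)| + |c m s / (2 * (ε ^ 2 + s) * √(ε ^ 2 + s))|) :=
              mul_le_mul_of_nonneg_left (abs_sub _ _) hs
          _ ≤ _ := by rw [mul_add]; exact add_le_add h1 h2
      linarith

/-- In `ℝ³` the divergence of `x / √(ε² + |x|²)` is at least `2 / √(ε² + |x|²)`. -/
theorem le_blockEnergy_regProfile {c c' : ℝ → ℝ → ℝ} (h : IsCutoff c c') {ε m s : ℝ} (hε : 0 < ε)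
    (hm : 0 ≤ m) (hs : 0 ≤ s) :
    2 * c m s / √(ε ^ 2 + s) + 2 * s * c' m s / √(ε ^ 2 + s) - c m s ^ 2 ≤
      blockEnergy (regProfile c ε) (regProfileDeriv c c' ε) m s := by
  have hpos : 0 < ε ^ 2 + s := by positivity
  have hr : 0 < √(ε ^ 2 + s) := Real.sqrt_pos.mpr hpos
  have c0 := h.nonneg m s hm hs
  have h1 : s * (c m s / √(ε ^ 2 + s)) ^ 2 ≤ c m s ^ 2 := by
    rw [div_pow, Real.sq_sqrt hpos.le, ← mul_div_assoc, div_le_iff₀ hpos]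
    nlinarith [sq_nonneg (c m s), sq_nonneg ε, mul_nonneg (sq_nonneg (c m s)) (sq_nonneg ε)]
  have h2 : 2 * s * (c m s / (2 * (ε ^ 2 + s) * √(ε ^ 2 + s))) ≤ c m s / √(ε ^ 2 + s) := by
    rw [← mul_div_assoc, div_le_div_iff₀ (by positivity) hr]
    have : 2 * s * c m s ≤ c m s * (2 * (ε ^ 2 + s)) := by
      nlinarith [mul_nonneg c0 (sq_nonneg ε)]
    calc _ ≤ c m s * (2 * (ε ^ 2 + s)) * √(ε ^ 2 + s) := mul_le_mul_of_nonneg_right this hr.le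
      _ = _ := by ring
  rw [blockEnergy, regProfileDeriv, regProfile]
  have e1 : 2 * s * (c' m s / √(ε ^ 2 + s) - c m s / (2 * (ε ^ 2 + s) * √(ε ^ 2 + s))) =
    2 * s * c' m s / √(ε ^ 2 + s) - 2 * s * (c m s / (2 * (ε ^ 2 + s) * √(ε ^ 2 + s))) := by ring
  have e2 : 2 * c m s / √(ε ^ 2 + s) = 2 * (c m s / √(ε ^ 2 + s)) := by ring
  rw [e1, e2]
  linarith

/-- Fatou's lemma for nonnegative functions with bounded integrals. -/
theorem integrable_of_integral_le_of_tendsto {α : Type*} [MeasurableSpace α] {μ : Measure α}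
    {f : ℕ → α → ℝ} {F : α → ℝ} {C : ℝ} (hf₀ : ∀ n x, 0 ≤ f n x) (hfi : ∀ n, Integrable (f n) μ)
    (hC : ∀ n, ∫ x, f n x ∂μ ≤ C)
    (hlim : ∀ᵐ x ∂μ, Tendsto (fun n => f n x) atTop (𝓝 (F x))) : Integrable F μ := by
  refine ⟨aestronglyMeasurable_of_tendsto_ae atTop (fun n => (hfi n).1) hlim, ?_⟩
  have h1 : ∫⁻ x, ‖F x‖ₑ ∂μ ≤ liminf (fun n => ∫⁻ x, ‖f n x‖ₑ ∂μ) atTop := by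
    calc ∫⁻ x, ‖F x‖ₑ ∂μ = ∫⁻ x, liminf (fun n => ‖f n x‖ₑ) atTop ∂μ := by
          refine lintegral_congr_ae ?_
          filter_upwards [hlim] with x hx
          exact (hx.enorm.liminf_eq).symm
      _ ≤ _ := lintegral_liminf_le' fun n => (hfi n).1.enorm
  refine lt_of_le_of_lt (h1.trans ?_ : _ ≤ ENNReal.ofReal C) ENNReal.ofReal_lt_top
  refine (liminf_le_liminf (Eventually.of_forall fun n => ?_)).trans
    (liminf_const (f := atTop (α := ℕ)) (ENNReal.ofReal C)).le
  change ∫⁻ x, ‖f n x‖ₑ ∂μ ≤ ENNReal.ofReal C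
  rw [← ofReal_integral_norm_eq_lintegral_enorm (hfi n)]
  refine ENNReal.ofReal_le_ofReal (le_trans (le_of_eq ?_) (hC n))
  simp only [Real.norm_of_nonneg (hf₀ n _)]

theorem ae_fst_ne_zero : ∀ᵐ x : Config, x.fst ≠ 0 := by
  have h := Measure.addHaar_submodule (volume : Measure Config)
    (LinearMap.ker (WithLp.fstL 2 ℝ (EuclideanSpace ℝ (Fin 3)) (EuclideanSpace ℝ (Fin 3))).toLinearMap)
    (by
      intro h
      have h1 : configBasis (Sum.inl 0) ∈ (⊤ : Submodule ℝ Config) := trivial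
      rw [← h, LinearMap.mem_ker, configBasis_inl] at h1
      simp at h1)
  rw [ae_iff]
  convert h using 2
  ext x
  simp

theorem ae_snd_ne_zero : ∀ᵐ x : Config, x.snd ≠ 0 := by
  have h := Measure.addHaar_submodule (volume : Measure Config)
    (LinearMap.ker (WithLp.sndL 2 ℝ (EuclideanSpace ℝ (Fin 3)) (EuclideanSpace ℝ (Fin 3))).toLinearMap)
    (by
      intro h
      have h1 : configBasis (Sum.inr 0) ∈ (⊤ : Submodule ℝ Config) := trivial
      rw [← h, LinearMap.mem_ker, configBasis_inr] at h1
      simp at h1)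
  rw [ae_iff]
  convert h using 2
  ext x
  simp

theorem integrable_potential_mul {U : ℝ} {ψ : StateSpace}
    (hψ : IsHamiltonianImage U ψ ((-(1 / 4) : ℂ) • ψ)) :
    Integrable fun x => (1 / 4 + potential U x) * ‖ψ x‖ ^ 2 := by
  obtain ⟨-, T, -, heq⟩ := hψ
  refine (integrable_inner_of_memLp (Lp.memLp ψ) (Lp.memLp T)).neg.congr ?_
  filter_upwards [inner_eq_of_eigenvalue heq] with x h1
  rw [Pi.neg_apply, h1, neg_neg]

theorem isCutoff_one : IsCutoff (fun _ _ => 1) (fun _ _ => 0) where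
  hasDerivAt m s _ _ := hasDerivAt_const s 1
  continuous := continuous_const
  continuous_deriv := continuous_const
  nonneg _ _ _ _ := zero_le_one
  le_one _ _ _ _ := le_rfl
  bounded := ⟨0, by simp⟩

/-- The scales `ε = 1 / (n + 1)` of the regularization. -/
noncomputable def regScale (n : ℕ) : ℝ := 1 / ((n : ℝ) + 1)

theorem regScale_pos (n : ℕ) : 0 < regScale n := by unfold regScale; positivity

theorem tendsto_inv_sqrt_regScale {r : ℝ} (hr : 0 < r) :
    Tendsto (fun n => 1 / √(regScale n ^ 2 + r ^ 2)) atTop (𝓝 (1 / r)) := by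
  have h1 : Tendsto regScale atTop (𝓝 0) := tendsto_one_div_add_atTop_nhds_zero_nat
  have h2 : Tendsto (fun n => √(regScale n ^ 2 + r ^ 2)) atTop (𝓝 r) := by
    have := ((h1.pow 2).add_const (r ^ 2)).sqrt
    simpa [Real.sqrt_sq hr.le] using this
  exact tendsto_const_nhds.div h2 hr.ne'

theorem bddCont_inv_sqrt {ε : ℝ} (hε : 0 < ε) {u : Config → EuclideanSpace ℝ (Fin 3)}
    (hu : Continuous u) : BddCont fun x => 1 / √(ε ^ 2 + ‖u x‖ ^ 2) := by
  refine .of_le (continuous_const.div (by fun_prop) fun x => ?_) (1 / ε) fun x => ?_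
  · have : 0 < ε ^ 2 + ‖u x‖ ^ 2 := by positivity
    positivity
  · rw [abs_of_nonneg (by positivity)]
    exact one_div_le_one_div_of_le hε (le_sqrt_sq_add (by positivity))

/-- Finiteness of the nuclear Coulomb energy of a bound state. It follows from the energy bound
with weight `1` and the fields `x₁ / |x₁|`, `x₂ / |x₂|`, whose divergences are `2 / |x₁|` and
`2 / |x₂|`. -/
theorem integrable_coulomb {U : ℝ} {ψ : StateSpace}
    (hψ : IsHamiltonianImage U ψ ((-(1 / 4) : ℂ) • ψ)) :
    Integrable fun x : Config => (1 / ‖x.fst‖ + 1 / ‖x.snd‖) * ‖ψ x‖ ^ 2 := by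
  have i0 := integrable_norm_sq ψ
  have iV := integrable_potential_mul hψ
  have hb : ∀ n, BddCont fun x : Config => 1 / √(regScale n ^ 2 + ‖x.fst‖ ^ 2) +
      1 / √(regScale n ^ 2 + ‖x.snd‖ ^ 2) := fun n =>
    (bddCont_inv_sqrt (regScale_pos n) continuous_fst_config).add
      (bddCont_inv_sqrt (regScale_pos n) continuous_snd_config)
  refine integrable_of_integral_le_of_tendsto (f := fun n x =>
    (1 / √(regScale n ^ 2 + ‖x.fst‖ ^ 2) + 1 / √(regScale n ^ 2 + ‖x.snd‖ ^ 2)) * ‖ψ x‖ ^ 2)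
    (C := (2 * (∫ x, ‖ψ x‖ ^ 2) - ∫ x, (1 / 4 + potential U x) * ‖ψ x‖ ^ 2) / 2)
    (fun n x => by positivity) (fun n => (hb n).integrable_mul i0) (fun n => ?_) ?_
  · obtain ⟨h1, h2⟩ := weighted_energy_le_zero hψ (G := fun _ => 0) (g := fun _ _ => 0)
      (BddCont.const 0) (fun _ => BddCont.const 0)
      (fun i x => by simpa [HasLineDerivAt] using hasDerivAt_const (0 : ℝ) (0 : ℝ))
      (isProfile_regProfile isCutoff_one (regScale_pos n))
    have iR : Integrable fun x => (1 / 4 + potential U x) * ‖ψ x‖ ^ 2 - 2 * ‖ψ x‖ ^ 2 :=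
      iV.sub (i0.const_mul 2)
    have h3 : ∫ x, (2 * ((1 / √(regScale n ^ 2 + ‖x.fst‖ ^ 2) +
        1 / √(regScale n ^ 2 + ‖x.snd‖ ^ 2)) * ‖ψ x‖ ^ 2) +
        ((1 / 4 + potential U x) * ‖ψ x‖ ^ 2 - 2 * ‖ψ x‖ ^ 2)) ≤ 0 := by
      refine (integral_mono ((((hb n).integrable_mul i0).const_mul 2).add iR) h1 fun x => ?_).trans h2
      have b1 := le_blockEnergy_regProfile isCutoff_one (m := ‖x.snd‖ ^ 2) (s := ‖x.fst‖ ^ 2)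
        (regScale_pos n) (by positivity) (by positivity)
      have b2 := le_blockEnergy_regProfile isCutoff_one (m := ‖x.fst‖ ^ 2) (s := ‖x.snd‖ ^ 2)
        (regScale_pos n) (by positivity) (by positivity)
      have key := mul_le_mul_of_nonneg_right (add_le_add b1 b2) (sq_nonneg ‖ψ x‖)
      simp only [Pi.add_apply, mul_zero, Real.exp_zero, one_mul, zero_pow two_ne_zero, Finset.sum_const_zero,
        sub_zero]
      refine le_trans (le_of_eq ?_) (add_le_add_left key ((1 / 4 + potential U x) * ‖ψ x‖ ^ 2))
        |>.trans_eq (by ring)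
      ring
    rw [integral_add (((hb n).integrable_mul i0).const_mul 2) iR,
      integral_sub iV (i0.const_mul 2), integral_const_mul, integral_const_mul] at h3
    linarith
  · filter_upwards [ae_fst_ne_zero, ae_snd_ne_zero] with x h1 h2
    exact ((tendsto_inv_sqrt_regScale (norm_pos_iff.mpr h1)).add
      (tendsto_inv_sqrt_regScale (norm_pos_iff.mpr h2))).mul_const _

/-- The positive defect `1 / r - 1 / √(ε² + r²)` of the regularized Coulomb potential. -/
noncomputable def coulombDefect (ε r : ℝ) : ℝ := 1 / r - 1 / √(ε ^ 2 + r ^ 2)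

theorem coulombDefect_nonneg {ε r : ℝ} (hr : 0 < r) : 0 ≤ coulombDefect ε r := by
  have h : r ≤ √(ε ^ 2 + r ^ 2) := Real.le_sqrt_of_sq_le (by nlinarith [sq_nonneg ε])
  exact sub_nonneg.mpr (one_div_le_one_div_of_le hr h)

theorem coulombDefect_le {ε r : ℝ} : coulombDefect ε r ≤ 1 / r :=
  sub_le_self _ (by positivity)

/-- Removal of the regularization: a bounded function that lies below
`1/4 + V + div z - |z|² - |∇G|²` up to the Coulomb defects has nonpositive weighted average. -/
theorem integral_weight_mul_le_zero {U : ℝ} {ψ : StateSpace}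
    (hψ : IsHamiltonianImage U ψ ((-(1 / 4) : ℂ) • ψ)) {G : Config → ℝ}
    {g : Fin 3 ⊕ Fin 3 → Config → ℝ} (hG : BddCont G) (hg : ∀ i, BddCont (g i))
    (hGd : ∀ i x, HasLineDerivAt ℝ G (g i x) x (configBasis i))
    {c c' : ℝ → ℝ → ℝ} (hc : IsCutoff c c') {p : Config → ℝ} (hpm : Measurable p) {B : ℝ}
    (hpB : ∀ x, |p x| ≤ B)
    (hp : ∀ ε : ℝ, 0 < ε → ∀ x : Config, 0 < ‖x.fst‖ → 0 < ‖x.snd‖ →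
      p x ≤ 1 / 4 + potential U x +
        (blockEnergy (regProfile c ε) (regProfileDeriv c c' ε) (‖x.snd‖ ^ 2) (‖x.fst‖ ^ 2) +
        blockEnergy (regProfile c ε) (regProfileDeriv c c' ε) (‖x.fst‖ ^ 2) (‖x.snd‖ ^ 2)) -
        ∑ i, g i x ^ 2 + (coulombDefect ε ‖x.fst‖ + coulombDefect ε ‖x.snd‖)) :
    ∫ x, Real.exp (2 * G x) * (p x * ‖ψ x‖ ^ 2) ≤ 0 := by
  have i0 := integrable_norm_sq ψ
  have iC := integrable_coulomb hψ
  have hW : BddCont fun x => Real.exp (2 * G x) := hG.exp_two_mul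
  have ip : Integrable fun x => Real.exp (2 * G x) * (p x * ‖ψ x‖ ^ 2) :=
    hW.integrable_mul (i0.bdd_mul hpm.aestronglyMeasurable (ae_of_all _ hpB))
  have hpos : ∀ᵐ x : Config, 0 < ‖x.fst‖ ∧ 0 < ‖x.snd‖ := by
    filter_upwards [ae_fst_ne_zero, ae_snd_ne_zero] with x h1 h2
    exact ⟨norm_pos_iff.mpr h1, norm_pos_iff.mpr h2⟩
  have iD : ∀ n, Integrable fun x : Config => Real.exp (2 * G x) *
      ((coulombDefect (regScale n) ‖x.fst‖ + coulombDefect (regScale n) ‖x.snd‖) * ‖ψ x‖ ^ 2) := by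
    intro n
    refine hW.integrable_mul ?_
    refine (iC.sub (((bddCont_inv_sqrt (regScale_pos n) continuous_fst_config).add
      (bddCont_inv_sqrt (regScale_pos n) continuous_snd_config)).integrable_mul i0)).congr ?_
    refine ae_of_all _ fun x => ?_
    simp only [coulombDefect, Pi.sub_apply]
    ring
  have hlim : Tendsto (fun n => ∫ x : Config, Real.exp (2 * G x) *
      ((coulombDefect (regScale n) ‖x.fst‖ + coulombDefect (regScale n) ‖x.snd‖) * ‖ψ x‖ ^ 2))
      atTop (𝓝 (∫ _ : Config, (0 : ℝ))) := by
    refine tendsto_integral_of_dominated_convergence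
      (fun x => Real.exp (2 * G x) * ((1 / ‖x.fst‖ + 1 / ‖x.snd‖) * ‖ψ x‖ ^ 2))
      (fun n => (iD n).1) (hW.integrable_mul iC) (fun n => ?_) ?_
    · filter_upwards [hpos] with x hx
      have d1 := coulombDefect_nonneg (ε := regScale n) hx.1
      have d2 := coulombDefect_nonneg (ε := regScale n) hx.2
      have d3 := coulombDefect_le (ε := regScale n) (r := ‖x.fst‖)
      have d4 := coulombDefect_le (ε := regScale n) (r := ‖x.snd‖)
      rw [Real.norm_of_nonneg (by positivity)]
      gcongr
    · filter_upwards [hpos] with x hx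
      have t1 := (tendsto_inv_sqrt_regScale hx.1).const_sub (1 / ‖x.fst‖)
      have t2 := (tendsto_inv_sqrt_regScale hx.2).const_sub (1 / ‖x.snd‖)
      have := ((t1.add t2).mul_const (‖ψ x‖ ^ 2)).const_mul (Real.exp (2 * G x))
      simpa [coulombDefect] using this
  rw [integral_zero] at hlim
  refine ge_of_tendsto' hlim fun n => ?_
  obtain ⟨h1, h2⟩ := weighted_energy_le_zero hψ hG hg hGd
    (isProfile_regProfile hc (regScale_pos n))
  have h3 := integral_mono_ae ip (h1.add (iD n)) (by
    filter_upwards [hpos] with x hx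
    have h := hp (regScale n) (regScale_pos n) x hx.1 hx.2
    have h' := mul_le_mul_of_nonneg_left (mul_le_mul_of_nonneg_right h (sq_nonneg ‖ψ x‖))
      (Real.exp_pos (2 * G x)).le
    refine h'.trans_eq ?_
    simp only [Pi.add_apply]
    ring)
  rw [integral_add' h1 (iD n)] at h3
  linarith

/-! ### The energy gap at infinity and the Agmon estimate -/

/-- The cutoff `½ (1 - s / (b (1 + m)))₊²`: with `s = |x₁|²` and `m = |x₂|²` it is close to `1/2`
where `x₁` is near the nucleus compared with `x₂`, and it vanishes where
`|x₁|² ≥ b (1 + |x₂|²)`. -/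
noncomputable def coneCutoff (b m s : ℝ) : ℝ := (max 0 (1 - s / (b * (1 + m)))) ^ 2 / 2

/-- The derivative of `coneCutoff b m s` in `s`. -/
noncomputable def coneCutoffDeriv (b m s : ℝ) : ℝ :=
  -(max 0 (1 - s / (b * (1 + m))) / (b * (1 + m)))

theorem hasDerivAt_max_zero_sq (y : ℝ) :
    HasDerivAt (fun y : ℝ => (max 0 y) ^ 2) (2 * max 0 y) y := by
  rcases lt_trichotomy y 0 with h | rfl | h
  · rw [max_eq_left h.le, mul_zero]
    refine (hasDerivAt_const y (0 : ℝ)).congr_of_eventuallyEq ?_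
    filter_upwards [Iio_mem_nhds h] with z hz
    simp [max_eq_left (show z ≤ 0 from le_of_lt hz)]
  · rw [hasDerivAt_iff_isLittleO_nhds_zero]
    have h1 : (fun h : ℝ => h ^ 2) =o[𝓝 0] fun h => h := by
      simpa [pow_one] using Asymptotics.isLittleO_pow_pow (𝕜 := ℝ) (m := 1) (n := 2) (by norm_num)
    refine (Asymptotics.IsBigO.of_bound 1 (Eventually.of_forall fun h => ?_)).trans_isLittleO h1
    simp only [zero_add, max_self, mul_zero, smul_zero, sub_zero, ne_eq, OfNat.ofNat_ne_zero,
      not_false_eq_true, zero_pow, one_mul, norm_pow, Real.norm_eq_abs]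
    refine pow_le_pow_left₀ (abs_nonneg _) ?_ 2
    rw [abs_of_nonneg (le_max_left 0 h)]
    exact max_le (abs_nonneg _) (le_abs_self _)
  · rw [max_eq_right h.le]
    have := (hasDerivAt_pow 2 y)
    simp only [Nat.cast_ofNat, Nat.add_one_sub_one, pow_one] at this
    refine this.congr_of_eventuallyEq ?_
    filter_upwards [Ioi_mem_nhds h] with z hz
    simp [max_eq_right (show 0 ≤ z from le_of_lt hz)]

theorem isCutoff_cone {b : ℝ} (hb : 0 < b) : IsCutoff (coneCutoff b) (coneCutoffDeriv b) where
  hasDerivAt m s hm hs := by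
    have h1 : HasDerivAt (fun s => 1 - s / (b * (1 + m))) (-(1 / (b * (1 + m)))) s :=
      ((hasDerivAt_id s).div_const _).const_sub 1
    have h2 := ((hasDerivAt_max_zero_sq (1 - s / (b * (1 + m)))).comp s h1).div_const 2
    convert! h2 using 1
    rw [coneCutoffDeriv]
    ring
  continuous := by
    unfold coneCutoff
    have : ∀ p : ℝ × ℝ, b * (1 + p.1 ^ 2) ≠ 0 := fun p => by positivity
    fun_prop (disch := assumption)
  continuous_deriv := by
    unfold coneCutoffDeriv
    have : ∀ p : ℝ × ℝ, b * (1 + p.1 ^ 2) ≠ 0 := fun p => by positivity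
    fun_prop (disch := assumption)
  nonneg m s _ _ := by unfold coneCutoff; positivity
  le_one m s hm hs := by
    have h0 : 0 ≤ s / (b * (1 + m)) := by positivity
    have h1 : max 0 (1 - s / (b * (1 + m))) ≤ 1 := max_le zero_le_one (by linarith)
    have h2 : max 0 (1 - s / (b * (1 + m))) ^ 2 ≤ 1 := pow_le_one₀ (le_max_left _ _) h1
    unfold coneCutoff
    linarith
  bounded := by
    refine ⟨1, fun m s hm hs => ?_⟩
    have hM : 0 < b * (1 + m) := by positivity
    have h0 : 0 ≤ s / (b * (1 + m)) := by positivity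
    rw [coneCutoffDeriv, abs_neg, abs_of_nonneg (by positivity)]
    have e : s * (max 0 (1 - s / (b * (1 + m))) / (b * (1 + m))) =
      s / (b * (1 + m)) * max 0 (1 - s / (b * (1 + m))) := by ring
    rw [e]
    rcases le_total (s / (b * (1 + m))) 1 with h | h
    · rw [max_eq_right (by linarith)]
      nlinarith
    · rw [max_eq_left (by linarith)]
      simp

/-- With the field of `coneCutoff`, one block of the energy density compensates the attraction
`- 1 / r` up to the hydrogen ground state energy `-1/4` and a quadratically small error; it is
nonnegative outside the support of the cutoff. -/
theorem blockEnergy_cone_ge {b m r ε : ℝ} (hb : 0 < b) (hm : 0 ≤ m) (hr : 0 < r) (hε : 0 < ε) :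
    (-(16 / (b * (1 + m))) ≤ 1 / 4 - 1 / r + coulombDefect ε r +
      blockEnergy (regProfile (coneCutoff b) ε)
        (regProfileDeriv (coneCutoff b) (coneCutoffDeriv b) ε) m (r ^ 2)) ∧
    (b * (1 + m) ≤ r ^ 2 → 0 ≤ coulombDefect ε r +
      blockEnergy (regProfile (coneCutoff b) ε)
        (regProfileDeriv (coneCutoff b) (coneCutoffDeriv b) ε) m (r ^ 2)) := by
  have hblock := le_blockEnergy_regProfile (isCutoff_cone hb) hε hm (sq_nonneg r)
  have hdef := coulombDefect_nonneg (ε := ε) hr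
  have hρ : 1 / √(ε ^ 2 + r ^ 2) = 1 / r - coulombDefect ε r := by rw [coulombDefect]; ring
  have hM : 0 < b * (1 + m) := by positivity
  set Z := blockEnergy (regProfile (coneCutoff b) ε)
        (regProfileDeriv (coneCutoff b) (coneCutoffDeriv b) ε) m (r ^ 2)
  set D := coulombDefect ε r
  set M := b * (1 + m)
  set R := 1 / √(ε ^ 2 + r ^ 2)
  have hR : 0 ≤ R := by positivity
  have hblock' : 2 * coneCutoff b m (r ^ 2) * R +
      2 * (r ^ 2 * coneCutoffDeriv b m (r ^ 2)) * R - coneCutoff b m (r ^ 2) ^ 2 ≤ Z := by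
    refine le_trans (le_of_eq ?_) hblock
    simp only [R]
    ring
  have hout : M ≤ r ^ 2 → 0 ≤ D + Z := by
    intro h
    have h1 : max 0 (1 - r ^ 2 / M) = 0 := max_eq_left (by
      rw [sub_nonpos, le_div_iff₀ hM]; linarith)
    simp only [coneCutoff, coneCutoffDeriv, M, h1] at hblock'
    norm_num at hblock'
    linarith
  refine ⟨?_, hout⟩
  rcases le_total M (r ^ 2) with h | h
  · have h1 := hout h
    have h2 : 0 < 16 / M := by positivity
    rcases le_total 4 r with h4 | h4
    · have : 1 / r ≤ 1 / 4 := one_div_le_one_div_of_le (by norm_num) h4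
      linarith
    · have : 1 / r ≤ 16 / M := by
        rw [div_le_div_iff₀ hr hM]
        nlinarith
      linarith
  · have hτ0 : 0 ≤ r ^ 2 / M := by positivity
    have hτ1 : r ^ 2 / M ≤ 1 := by rw [div_le_one hM]; exact h
    set τ := r ^ 2 / M with hτ
    have hc : coneCutoff b m (r ^ 2) = (1 - τ) ^ 2 / 2 := by
      simp only [coneCutoff]
      change (max 0 (1 - τ)) ^ 2 / 2 = _
      rw [max_eq_right (by linarith)]
    have hc' : r ^ 2 * coneCutoffDeriv b m (r ^ 2) = -(τ * (1 - τ)) := by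
      simp only [coneCutoffDeriv]
      change r ^ 2 * -((max 0 (1 - τ)) / M) = _
      rw [max_eq_right (by linarith), hτ]
      ring
    rw [hc, hc', hρ] at hblock'
    have hrinv : 0 ≤ 1 / r := by positivity
    have hD : D ≤ 1 / r := coulombDefect_le
    have hτr : τ * (1 / r) = r / M := by rw [hτ]; field_simp
    -- the errors of order `τ / r` are absorbed by the gain `τ / 4` of the kinetic energy
    have hquad : -(16 / M) ≤ τ / 4 - 4 * (r / M) := by
      have : τ / 4 - 4 * (r / M) + 16 / M = (r / 2 - 4) ^ 2 / M := by rw [hτ]; ring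
      have : 0 ≤ (r / 2 - 4) ^ 2 / M := by positivity
      linarith
    have hg : ((1 - τ) ^ 2 / 2) ^ 2 ≤ (1 - τ) / 4 := by
      have h1 : (1 - τ) ^ 2 ≤ 1 - τ := by nlinarith
      nlinarith [sq_nonneg (1 - τ)]
    have hlow : -(4 * τ) * (1 / r) ≤ ((1 - τ) ^ 2 - 2 * τ * (1 - τ) - 1) * (1 / r - D) - D + D := by
      have h1 : -(4 * τ) ≤ (1 - τ) ^ 2 - 2 * τ * (1 - τ) - 1 := by nlinarith
      have h2 : -(4 * τ) * (1 / r) ≤ -(4 * τ) * (1 / r - D) := by nlinarith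
      have h3 := mul_le_mul_of_nonneg_right h1 (by linarith : 0 ≤ 1 / r - D)
      linarith
    have e : 2 * ((1 - τ) ^ 2 / 2) * (1 / r - D) + 2 * -(τ * (1 - τ)) * (1 / r - D) =
        ((1 - τ) ^ 2 - 2 * τ * (1 - τ) - 1) * (1 / r - D) + (1 / r - D) := by ring
    linarith

/-- The lower bound for the energy density at distance `M = |x|_∞` from the nucleus: the electron
repulsion where the other electron is closer than `d M`, and the full binding energy `1/4`
elsewhere. -/
noncomputable def farGap (U d : ℝ) (x : Config) : ℝ :=
  if normMin x < d * normMax x then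
    (U / (1 + d) - 1) / normMax x - 32 / (d ^ 2 * normMax x ^ 2)
  else 1 / 4 - 2 / (d * normMax x)

/-- The energy density `1/4 + V + div z - |z|²` of the regularized field of `coneCutoff`,
corrected by the Coulomb defects that the regularization causes. -/
noncomputable def energyDensity (U b ε : ℝ) (x : Config) : ℝ :=
  1 / 4 + potential U x +
    (blockEnergy (regProfile (coneCutoff b) ε)
      (regProfileDeriv (coneCutoff b) (coneCutoffDeriv b) ε) (‖x.snd‖ ^ 2) (‖x.fst‖ ^ 2) +
    blockEnergy (regProfile (coneCutoff b) ε)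
      (regProfileDeriv (coneCutoff b) (coneCutoffDeriv b) ε) (‖x.fst‖ ^ 2) (‖x.snd‖ ^ 2)) +
    (coulombDefect ε ‖x.fst‖ + coulombDefect ε ‖x.snd‖)

theorem energyDensity_ge {U b ε : ℝ} (hU : 0 ≤ U) (hb : 0 < b) (hε : 0 < ε) {x : Config}
    (h₁ : 0 < ‖x.fst‖) (h₂ : 0 < ‖x.snd‖) :
    -(1 / 4 + 32 / b) ≤ energyDensity U b ε x := by
  have b1 := (blockEnergy_cone_ge hb (sq_nonneg ‖x.snd‖) h₁ hε).1
  have b2 := (blockEnergy_cone_ge hb (sq_nonneg ‖x.fst‖) h₂ hε).1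
  have hU' : 0 ≤ U / ‖x.fst - x.snd‖ := by positivity
  have key : ∀ m : ℝ, 0 ≤ m → 16 / (b * (1 + m)) ≤ 16 / b := fun m hm => by
    gcongr
    nlinarith
  have k1 := key _ (sq_nonneg ‖x.snd‖)
  have k2 := key _ (sq_nonneg ‖x.fst‖)
  have e : 32 / b = 16 / b + 16 / b := by ring
  rw [energyDensity, potential, e]
  linarith

/-- The gap at a point with `r' ≤ r`, where `X` stands for the electron repulsion and `Z₁`, `Z₂` for
the blocks of the outer and of the inner electron. The cutoff of the outer electron vanishes; the
inner one is either bound with energy `-1/4`, or outside its cutoff as well. -/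
theorem farGap_le_of_le {U d X Z₁ Z₂ r r' : ℝ} (hd : 0 < d) (hd₁ : d ≤ 1) (hr' : 0 < r')
    (hle : r' ≤ r) (hr : 1 ≤ r) (hX : 0 ≤ X) (hXU : r' < d * r → U / ((1 + d) * r) ≤ X)
    (h₁ : d ^ 2 / 2 * (1 + r' ^ 2) ≤ r ^ 2 → 0 ≤ Z₁)
    (h₂ : -(16 / (d ^ 2 / 2 * (1 + r ^ 2))) ≤ 1 / 4 - 1 / r' + Z₂)
    (h₃ : d ^ 2 / 2 * (1 + r ^ 2) ≤ r' ^ 2 → 0 ≤ Z₂) :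
    (if r' < d * r then (U / (1 + d) - 1) / r - 32 / (d ^ 2 * r ^ 2) else 1 / 4 - 2 / (d * r)) ≤
      1 / 4 - 1 / r - 1 / r' + X + Z₁ + Z₂ := by
  have hr0 : 0 < r := by linarith
  have hd2 : d ^ 2 ≤ 1 := pow_le_one₀ hd.le hd₁
  have hz : 0 ≤ Z₁ := h₁ (by nlinarith [mul_nonneg (sub_nonneg.mpr hd2) (sq_nonneg r')])
  split_ifs with h
  · have hX' := hXU h
    have e1 : U / ((1 + d) * r) = U / (1 + d) / r := by rw [div_div]
    have e2 : (U / (1 + d) - 1) / r = U / (1 + d) / r - 1 / r := by ring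
    have e3 : 16 / (d ^ 2 / 2 * (1 + r ^ 2)) ≤ 32 / (d ^ 2 * r ^ 2) := by
      rw [div_le_div_iff₀ (by positivity) (by positivity)]
      nlinarith [sq_nonneg d]
    rw [e2, ← e1]
    linarith
  · push Not at h
    have hz2 : 0 ≤ Z₂ := h₃ (by
      have h4 : (d * r) ^ 2 ≤ r' ^ 2 := pow_le_pow_left₀ (by positivity) h 2
      nlinarith [sq_nonneg d, mul_nonneg (sq_nonneg d) (by nlinarith : 0 ≤ r ^ 2 - 1)])
    have e1 : 1 / r' ≤ 1 / (d * r) := one_div_le_one_div_of_le (by positivity) h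
    have e2 : 1 / r ≤ 1 / (d * r) :=
      one_div_le_one_div_of_le (by positivity) (by nlinarith)
    have e3 : 2 / (d * r) = 1 / (d * r) + 1 / (d * r) := by ring
    linarith

theorem farGap_le_energyDensity {U d ε : ℝ} (hU : 0 ≤ U) (hd : 0 < d) (hd₁ : d < 1) (hε : 0 < ε)
    {x : Config} (h₁ : 0 < ‖x.fst‖) (h₂ : 0 < ‖x.snd‖) (hx : 1 ≤ normMax x) :
    farGap U d x ≤ energyDensity U (d ^ 2 / 2) ε x := by
  have hb : 0 < d ^ 2 / 2 := by positivity
  obtain ⟨b1, c1⟩ := blockEnergy_cone_ge hb (sq_nonneg ‖x.snd‖) h₁ hε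
  obtain ⟨b2, c2⟩ := blockEnergy_cone_ge hb (sq_nonneg ‖x.fst‖) h₂ hε
  have hX : 0 ≤ U / ‖x.fst - x.snd‖ := by positivity
  have hrep : ∀ {u v : EuclideanSpace ℝ (Fin 3)}, 0 < ‖u‖ → ‖v‖ < d * ‖u‖ →
      U / ((1 + d) * ‖u‖) ≤ U / ‖u - v‖ := by
    intro u v hu hv
    have h3 := norm_sub_le u v
    have h4 := norm_sub_norm_le u v
    have h5 : 0 < ‖u - v‖ := by nlinarith
    exact div_le_div_of_nonneg_left hU h5 (by linarith)
  rw [farGap, energyDensity, potential]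
  rcases le_total ‖x.snd‖ ‖x.fst‖ with h | h
  · have hM : normMax x = ‖x.fst‖ := max_eq_left h
    have hm : normMin x = ‖x.snd‖ := min_eq_right h
    rw [hM] at hx
    rw [hM, hm]
    refine (farGap_le_of_le hd hd₁.le h₂ h hx hX (hrep h₁) c1
      (Z₂ := coulombDefect ε ‖x.snd‖ + _) (by rw [← add_assoc]; exact b2) c2).trans_eq ?_
    ring
  · have hM : normMax x = ‖x.snd‖ := max_eq_right h
    have hm : normMin x = ‖x.fst‖ := min_eq_left h
    rw [hM] at hx
    rw [hM, hm]
    refine (farGap_le_of_le hd hd₁.le h₁ h hx hX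
      (fun h' => by rw [norm_sub_rev]; exact hrep h₂ h') c2
      (Z₂ := coulombDefect ε ‖x.fst‖ + _) (by rw [← add_assoc]; exact b1) c1).trans_eq ?_
    ring

theorem continuous_normMax : Continuous normMax :=
  continuous_fst_config.norm.max continuous_snd_config.norm

theorem normMax_nonneg (x : Config) : 0 ≤ normMax x := le_max_of_le_left (norm_nonneg _)

theorem norm_sq_le_normMax (x : Config) : ‖x‖ ^ 2 ≤ 2 * normMax x ^ 2 := by
  rw [WithLp.prod_norm_sq_eq_of_L2]
  have h1 : ‖x.fst‖ ^ 2 ≤ normMax x ^ 2 := pow_le_pow_left₀ (norm_nonneg _) (le_max_left _ _) 2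
  have h2 : ‖x.snd‖ ^ 2 ≤ normMax x ^ 2 := pow_le_pow_left₀ (norm_nonneg _) (le_max_right _ _) 2
  linarith

/-- Agmon estimate: if `|∇G|²` stays below the local gap `farGap` by `c / |x|_∞` at
infinity, then `e^G ψ` is square integrable up to a factor `√(1 + |x|_∞)`. -/
theorem integrable_exp_mul_of_gap {U d : ℝ} {ψ : StateSpace}
    (hψ : IsHamiltonianImage U ψ ((-(1 / 4) : ℂ) • ψ)) (hU : 0 ≤ U) (hd : 0 < d) (hd₁ : d < 1)
    {G : Config → ℝ} {g : Fin 3 ⊕ Fin 3 → Config → ℝ} (hG : Continuous G) (hG₀ : ∀ x, 0 ≤ G x)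
    (hg : ∀ i, Continuous (g i)) {C : ℝ} (hgC : ∀ x, ∑ i, g i x ^ 2 ≤ C)
    (hGd : ∀ i x, HasLineDerivAt ℝ G (g i x) x (configBasis i)) {c R : ℝ} (hc : 0 < c)
    (hR : 1 ≤ R)
    (hfar : ∀ x, R ≤ normMax x → ∑ i, g i x ^ 2 + c / normMax x ≤ farGap U d x) :
    Integrable fun x => Real.exp (2 * G x) / (1 + normMax x) * ‖ψ x‖ ^ 2 := by
  have i0 := integrable_norm_sq ψ
  have hb : 0 < d ^ 2 / 2 := by positivity
  have hC0 : 0 ≤ C := le_trans (Finset.sum_nonneg fun i _ => sq_nonneg _) (hgC 0)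
  obtain ⟨S, hS⟩ : ∃ S, ∀ x, normMax x ≤ R → G x ≤ S := by
    obtain ⟨S, hS⟩ := (isCompact_closedBall (0 : Config) (2 * R)).bddAbove_image hG.continuousOn
    refine ⟨S, fun x hx => hS ⟨x, ?_, rfl⟩⟩
    rw [mem_closedBall_zero_iff]
    have h1 := norm_sq_le_normMax x
    have h2 := normMax_nonneg x
    exact abs_le_of_sq_le_sq' (by nlinarith) (by linarith) |>.2
  -- `B` bounds the energy density from below on the ball where the gap is not available
  set B := 1 / 4 + 32 / (d ^ 2 / 2) + C with hB
  have hB0 : 0 ≤ B := by positivity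
  let p : Config → ℝ := fun x => if normMax x < R then -B else c / normMax x
  have hpm : Measurable p :=
    Measurable.ite (measurableSet_lt continuous_normMax.measurable measurable_const)
      measurable_const (measurable_const.div continuous_normMax.measurable)
  have hpB : ∀ x, |p x| ≤ B + c := by
    intro x
    simp only [p]
    split_ifs with h
    · rw [abs_neg, abs_of_nonneg hB0]
      linarith
    · push Not at h
      rw [abs_of_nonneg (by have := normMax_nonneg x; positivity)]
      have : c / normMax x ≤ c := div_le_self hc.le (by linarith)
      linarith
  have hden : ∀ n x, 1 ≤ 1 + regScale n * G x := fun n x => by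
    have := mul_nonneg (regScale_pos n).le (hG₀ x)
    linarith
  -- the bounded functions `G / (1 + ε G)` increase to `G` and have smaller gradients
  let Gt : ℕ → Config → ℝ := fun n x => G x / (1 + regScale n * G x)
  let gt : ℕ → Fin 3 ⊕ Fin 3 → Config → ℝ := fun n i x => g i x / (1 + regScale n * G x) ^ 2
  have hGt0 : ∀ n x, 0 ≤ Gt n x := fun n x => div_nonneg (hG₀ x) (by linarith [hden n x])
  have hGtle : ∀ n x, Gt n x ≤ G x := fun n x => div_le_self (hG₀ x) (hden n x)
  have hdenc : ∀ n, Continuous fun x => 1 + regScale n * G x := fun n => by fun_prop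
  have hGtb : ∀ n, BddCont (Gt n) := fun n => by
    refine .of_le (hG.div (hdenc n) fun x => by linarith [hden n x]) (1 / regScale n) fun x => ?_
    rw [abs_of_nonneg (hGt0 n x), div_le_div_iff₀ (by linarith [hden n x]) (regScale_pos n)]
    linarith
  have hgtsq : ∀ n i x, gt n i x ^ 2 ≤ g i x ^ 2 := fun n i x => by
    simp only [gt]
    rw [div_pow]
    exact div_le_self (sq_nonneg _) (one_le_pow₀ (one_le_pow₀ (hden n x)))
  have hgtsum : ∀ n x, ∑ i, gt n i x ^ 2 ≤ ∑ i, g i x ^ 2 := fun n x =>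
    Finset.sum_le_sum fun i _ => hgtsq n i x
  have hgtb : ∀ n i, BddCont (gt n i) := fun n i => by
    refine .of_le ((hg i).div ((hdenc n).pow 2) fun x => ?_) (1 + C) fun x => ?_
    · have := hden n x
      positivity
    · have h1 : gt n i x ^ 2 ≤ C := (hgtsq n i x).trans
        ((Finset.single_le_sum (f := fun i => g i x ^ 2) (fun i _ => sq_nonneg _)
          (Finset.mem_univ i)).trans (hgC x))
      change |gt n i x| ≤ _
      rw [abs_le]
      constructor <;> nlinarith
  have hGtd : ∀ n i x, HasLineDerivAt ℝ (Gt n) (gt n i x) x (configBasis i) := fun n i x => by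
    have h := hGd i x
    have h0 := hden n x
    simp only [HasLineDerivAt] at h ⊢
    convert! h.div ((h.const_mul (regScale n)).const_add 1) ?_ using 1
    · simp only [zero_smul, add_zero, gt]
      congr 1
      ring
    · simp only [zero_smul, add_zero]
      linarith
  have hmain : ∀ n, ∫ x, Real.exp (2 * Gt n x) * (p x * ‖ψ x‖ ^ 2) ≤ 0 := fun n => by
    refine integral_weight_mul_le_zero hψ (hGtb n) (hgtb n) (hGtd n) (isCutoff_cone hb) hpm hpB
      fun ε hε x h1 h2 => ?_
    have key : p x + ∑ i, gt n i x ^ 2 ≤ energyDensity U (d ^ 2 / 2) ε x := by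
      simp only [p]
      split_ifs with h
      · have h3 := energyDensity_ge hU hb hε h1 h2
        have h4 := (hgtsum n x).trans (hgC x)
        linarith
      · push Not at h
        have h3 := farGap_le_energyDensity hU hd hd₁ hε h1 h2 (hR.trans h)
        linarith [hfar x h, hgtsum n x]
    rw [energyDensity] at key
    linarith
  have hEb : ∀ n, BddCont fun x => Real.exp (2 * Gt n x) := fun n => (hGtb n).exp_two_mul
  have hinv : BddCont fun x => 1 / (1 + normMax x) := by
    refine .of_le (continuous_const.div (continuous_const.add continuous_normMax) fun x => ?_) 1
      fun x => ?_
    · linarith [normMax_nonneg x]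
    · have := normMax_nonneg x
      rw [abs_of_nonneg (by positivity)]
      exact div_le_self zero_le_one (by linarith)
  have ifn : ∀ n, Integrable fun x => Real.exp (2 * Gt n x) / (1 + normMax x) * ‖ψ x‖ ^ 2 :=
    fun n => by
      refine (((hEb n).mul hinv).integrable_mul i0).congr (ae_of_all _ fun x => ?_)
      simp only
      ring
  refine integrable_of_integral_le_of_tendsto
    (f := fun n x => Real.exp (2 * Gt n x) / (1 + normMax x) * ‖ψ x‖ ^ 2)
    (C := (B + c) * Real.exp (2 * S) * (∫ x, ‖ψ x‖ ^ 2) / c) (fun n x => ?_) ifn (fun n => ?_)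
    (ae_of_all _ fun x => ?_)
  · have := normMax_nonneg x
    positivity
  · have ip : Integrable fun x => Real.exp (2 * Gt n x) * (p x * ‖ψ x‖ ^ 2) :=
      (hEb n).integrable_mul (i0.bdd_mul hpm.aestronglyMeasurable (ae_of_all _ hpB))
    have h1 := integral_mono ((ifn n).const_mul c)
      (ip.add (i0.const_mul ((B + c) * Real.exp (2 * S)))) (fun x => by
        have hM := normMax_nonneg x
        have hE := Real.exp_pos (2 * Gt n x)
        have hpt : c * (Real.exp (2 * Gt n x) / (1 + normMax x)) ≤
            Real.exp (2 * Gt n x) * p x + (B + c) * Real.exp (2 * S) := by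
          have hdiv : Real.exp (2 * Gt n x) / (1 + normMax x) ≤ Real.exp (2 * Gt n x) :=
            div_le_self hE.le (by linarith)
          simp only [p]
          split_ifs with h
          · have h2 : Real.exp (2 * Gt n x) ≤ Real.exp (2 * S) :=
              Real.exp_le_exp.mpr (by linarith [hGtle n x, hS x h.le])
            nlinarith
          · push Not at h
            have h2 : Real.exp (2 * Gt n x) / (1 + normMax x) ≤
                Real.exp (2 * Gt n x) / normMax x :=
              div_le_div_of_nonneg_left hE.le (by linarith) (by linarith)
            have h3 : 0 ≤ (B + c) * Real.exp (2 * S) := by positivity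
            have h4 := mul_le_mul_of_nonneg_left h2 hc.le
            calc _ ≤ c * (Real.exp (2 * Gt n x) / normMax x) := h4
              _ = Real.exp (2 * Gt n x) * (c / normMax x) := by ring
              _ ≤ _ := by linarith
        have h5 := mul_le_mul_of_nonneg_right hpt (sq_nonneg ‖ψ x‖)
        simp only [Pi.add_apply]
        linarith)
    rw [integral_add' ip (i0.const_mul _), integral_const_mul, integral_const_mul] at h1
    rw [le_div_iff₀ hc]
    linarith [hmain n]
  · have h1 : Tendsto regScale atTop (𝓝 0) := tendsto_one_div_add_atTop_nhds_zero_nat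
    have h2 : Tendsto (fun n => 1 + regScale n * G x) atTop (𝓝 1) := by
      simpa using (h1.mul_const (G x)).const_add 1
    have h3 : Tendsto (fun n => Gt n x) atTop (𝓝 (G x)) := by
      have := (tendsto_const_nhds (x := G x)).div h2 one_ne_zero
      rwa [div_one] at this
    exact (((Real.continuous_exp.tendsto _).comp (h3.const_mul 2)).div_const _).mul_const _

/-! ### The two decay phases -/

/-- The gradient of a function of `|x₁|²` and `|x₂|²` with partial derivatives `A` and `B`. -/
noncomputable def biradialGrad (A B : Config → ℝ) : Fin 3 ⊕ Fin 3 → Config → ℝ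
  | Sum.inl j, x => 2 * x.fst j * A x
  | Sum.inr j, x => 2 * x.snd j * B x

theorem sum_biradialGrad_sq (A B : Config → ℝ) (x : Config) :
    ∑ i, biradialGrad A B i x ^ 2 =
      (2 * ‖x.fst‖ * A x) ^ 2 + (2 * ‖x.snd‖ * B x) ^ 2 := by
  rw [Fintype.sum_sum_type]
  simp only [biradialGrad, mul_pow, ← sum_coord_sq, Fin.sum_univ_three]
  ring

theorem continuous_biradialGrad {A B : Config → ℝ} (hA : Continuous A) (hB : Continuous B) :
    ∀ i, Continuous (biradialGrad A B i)
  | Sum.inl j => by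
    have h : Continuous fun x : Config => x.fst j := by
      have := continuous_fst_config
      fun_prop
    exact (continuous_const.mul h).mul hA
  | Sum.inr j => by
    have h : Continuous fun x : Config => x.snd j := by
      have := continuous_snd_config
      fun_prop
    exact (continuous_const.mul h).mul hB

theorem hasLineDerivAt_biradial {Φ : ℝ → ℝ → ℝ} {A B : Config → ℝ}
    (hA : ∀ x : Config, HasDerivAt (fun s => Φ s (‖x.snd‖ ^ 2)) (A x) (‖x.fst‖ ^ 2))
    (hB : ∀ x : Config, HasDerivAt (fun s => Φ (‖x.fst‖ ^ 2) s) (B x) (‖x.snd‖ ^ 2)) :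
    ∀ i x, HasLineDerivAt ℝ (fun y : Config => Φ (‖y.fst‖ ^ 2) (‖y.snd‖ ^ 2))
      (biradialGrad A B i x) x (configBasis i)
  | Sum.inl j, x => hasLineDerivAt_inl x j (hA x) fun y hy => by rw [hy]
  | Sum.inr j, x => hasLineDerivAt_inr x j (hB x) fun y hy => by rw [hy]

/-- A radius beyond which `farGap` dominates the gradients of both phases used below; `κ` is the
strength `U / (1 + d) - 1` of the net repulsion. -/
noncomputable def gapRadius (κ d : ℝ) : ℝ := 1 + 164 / (d ^ 2 * κ) + 36 * (κ + 2 / d)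

theorem one_le_gapRadius {κ d : ℝ} (hκ : 0 < κ) (hd : 0 < d) : 1 ≤ gapRadius κ d := by
  have h1 : 0 < 164 / (d ^ 2 * κ) := by positivity
  have h2 : 0 < 36 * (κ + 2 / d) := by positivity
  unfold gapRadius
  linarith

/-- The gap condition of `integrable_exp_mul_of_gap` beyond `gapRadius`: the squared gradient `γ`
may use up half of the repulsion near the cone boundary and `2/9 < 1/4` elsewhere. -/
theorem add_le_farGap {U d γ : ℝ} (hd : 0 < d) (hκ : 0 < U / (1 + d) - 1) {x : Config}
    (hx : gapRadius (U / (1 + d) - 1) d ≤ normMax x)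
    (h₁ : normMin x < d * normMax x →
      γ ≤ (U / (1 + d) - 1) / (2 * normMax x) + 9 / (d ^ 2 * normMax x ^ 2))
    (h₂ : γ ≤ 2 / 9 + (U / (1 + d) - 1) / (2 * normMax x)) :
    γ + (U / (1 + d) - 1) / 4 / normMax x ≤ farGap U d x := by
  set κ := U / (1 + d) - 1
  set M := normMax x
  have hM : 0 < M := by linarith [one_le_gapRadius hκ hd]
  have p1 : 0 < 164 / (d ^ 2 * κ) := by positivity
  have p2 : 0 < 36 * (κ + 2 / d) := by positivity
  have hM1 : 164 / (d ^ 2 * κ) ≤ M := by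
    unfold gapRadius at hx
    linarith
  have hM2 : 36 * (κ + 2 / d) ≤ M := by
    unfold gapRadius at hx
    linarith
  unfold farGap
  split_ifs with h
  · have h3 := h₁ h
    have h4 : 41 / (d ^ 2 * M ^ 2) ≤ κ / 4 / M := by
      rw [div_le_iff₀ (by positivity)] at hM1
      rw [div_le_div_iff₀ (by positivity) hM]
      nlinarith
    have e1 : 41 / (d ^ 2 * M ^ 2) = 9 / (d ^ 2 * M ^ 2) + 32 / (d ^ 2 * M ^ 2) := by ring
    have e2 : κ / M = κ / (2 * M) + κ / 4 / M + κ / 4 / M := by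
      field_simp
      norm_num
    change γ + κ / 4 / M ≤ κ / M - 32 / (d ^ 2 * M ^ 2)
    linarith
  · have h4 : (κ + 2 / d) / M ≤ 1 / 36 := by
      rw [div_le_div_iff₀ hM (by norm_num)]
      linarith
    have e1 : (κ + 2 / d) / M = κ / (2 * M) + κ / 4 / M + κ / 4 / M + 2 / (d * M) := by
      field_simp
      ring
    have e2 : 0 < κ / 4 / M := by positivity
    change γ + κ / 4 / M ≤ 1 / 4 - 2 / (d * M)
    linarith

theorem normMax_sq_le (x : Config) : normMax x ^ 2 ≤ ‖x.fst‖ ^ 2 + ‖x.snd‖ ^ 2 := by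
  unfold normMax
  rcases max_cases ‖x.fst‖ ‖x.snd‖ with ⟨h, -⟩ | ⟨h, -⟩ <;> rw [h] <;>
    nlinarith [sq_nonneg ‖x.fst‖, sq_nonneg ‖x.snd‖]

theorem normMax_le_sqrt (x : Config) : normMax x ≤ √(1 + ‖x.fst‖ ^ 2 + ‖x.snd‖ ^ 2) :=
  Real.le_sqrt_of_sq_le (by linarith [normMax_sq_le x])

/-- The bound state decays at least like `e^{-√(2κ|x|)}`, where `κ` measures the repulsion of
an escaping electron by the remaining negative ion. -/
theorem integrable_exp_sqrt {U d : ℝ} {ψ : StateSpace}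
    (hψ : IsHamiltonianImage U ψ ((-(1 / 4) : ℂ) • ψ)) (hU : 0 ≤ U) (hd : 0 < d) (hd₁ : d < 1)
    (hκ : 0 < U / (1 + d) - 1) :
    Integrable fun x : Config =>
      Real.exp (2 * (√(2 * (U / (1 + d) - 1)) * √√(1 + ‖x.fst‖ ^ 2 + ‖x.snd‖ ^ 2))) /
        (1 + normMax x) * ‖ψ x‖ ^ 2 := by
  set κ := U / (1 + d) - 1 with hκd
  set a := √(2 * κ) with ha
  have ha2 : a ^ 2 = 2 * κ := Real.sq_sqrt (by positivity)
  let N : Config → ℝ := fun x => √(1 + ‖x.fst‖ ^ 2 + ‖x.snd‖ ^ 2)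
  have hN1 : ∀ x, 1 ≤ N x := fun x =>
    Real.le_sqrt_of_sq_le (by nlinarith [sq_nonneg ‖x.fst‖, sq_nonneg ‖x.snd‖])
  have hN2 : ∀ x, N x ^ 2 = 1 + ‖x.fst‖ ^ 2 + ‖x.snd‖ ^ 2 := fun x =>
    Real.sq_sqrt (by positivity)
  have hNc : Continuous N := by
    have h1 := continuous_fst_config
    have h2 := continuous_snd_config
    fun_prop
  let A : Config → ℝ := fun x => a * (1 / (2 * N x) / (2 * √(N x)))
  have hAc : Continuous A := by
    refine continuous_const.mul ((continuous_const.div (continuous_const.mul hNc) fun x => ?_).div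
      (continuous_const.mul hNc.sqrt) fun x => ?_)
    · have : 0 < N x := by linarith [hN1 x]
      exact (mul_pos two_pos this).ne'
    · have : 0 < N x := by linarith [hN1 x]
      exact (mul_pos two_pos (Real.sqrt_pos.mpr this)).ne'
  have hsum : ∀ x, ∑ i, biradialGrad A A i x ^ 2 ≤ κ / (2 * N x) := fun x => by
    have hn := hN1 x
    have hsq : √(N x) ^ 2 = N x := Real.sq_sqrt (by linarith)
    rw [sum_biradialGrad_sq]
    have e : (2 * ‖x.fst‖ * A x) ^ 2 + (2 * ‖x.snd‖ * A x) ^ 2 =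
        κ * (‖x.fst‖ ^ 2 + ‖x.snd‖ ^ 2) / (2 * N x ^ 2 * N x) := by
      have e1 : A x ^ 2 = 2 * κ / (16 * N x ^ 2 * N x) := by
        simp only [A, mul_pow, div_pow, ha2, hsq]
        field_simp
        norm_num
      have e2 : (2 * ‖x.fst‖ * A x) ^ 2 + (2 * ‖x.snd‖ * A x) ^ 2 =
          4 * (‖x.fst‖ ^ 2 + ‖x.snd‖ ^ 2) * A x ^ 2 := by ring
      rw [e2, e1]
      field_simp
      ring
    rw [e, div_le_div_iff₀ (by positivity) (by positivity)]
    have : ‖x.fst‖ ^ 2 + ‖x.snd‖ ^ 2 ≤ N x ^ 2 := by linarith [hN2 x]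
    calc κ * (‖x.fst‖ ^ 2 + ‖x.snd‖ ^ 2) * (2 * N x) ≤ κ * N x ^ 2 * (2 * N x) := by gcongr
      _ = κ * (2 * N x ^ 2 * N x) := by ring
  refine integrable_exp_mul_of_gap hψ hU hd hd₁ (g := biradialGrad A A) (C := κ / 2)
    (c := κ / 4) (R := gapRadius κ d) (continuous_const.mul hNc.sqrt) (fun x => by positivity)
    (continuous_biradialGrad hAc hAc) (fun x => ?_) ?_ (by positivity) (one_le_gapRadius hκ hd)
    (fun x hx => ?_)
  · refine (hsum x).trans (div_le_div_of_nonneg_left hκ.le two_pos ?_)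
    linarith [hN1 x]
  · refine hasLineDerivAt_biradial (Φ := fun s t => a * √√(1 + s + t)) (fun x => ?_) fun x => ?_
    · have h1 : HasDerivAt (fun s : ℝ => 1 + s + ‖x.snd‖ ^ 2) 1 (‖x.fst‖ ^ 2) :=
        ((hasDerivAt_id _).const_add 1).add_const _
      exact ((h1.sqrt (by positivity)).sqrt (by positivity)).const_mul a
    · have h1 : HasDerivAt (fun s : ℝ => 1 + ‖x.fst‖ ^ 2 + s) 1 (‖x.snd‖ ^ 2) :=
        (hasDerivAt_id _).const_add _
      exact ((h1.sqrt (by positivity)).sqrt (by positivity)).const_mul a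
  · have hM : 0 < normMax x := by linarith [one_le_gapRadius hκ hd]
    have h1 : ∑ i, biradialGrad A A i x ^ 2 ≤ κ / (2 * normMax x) := by
      refine (hsum x).trans (div_le_div_of_nonneg_left hκ.le (by positivity) ?_)
      linarith [normMax_le_sqrt x]
    have h2 : 0 ≤ 9 / (d ^ 2 * normMax x ^ 2) := by positivity
    exact add_le_farGap hd hκ hx (fun _ => by linarith) (by linarith)

/-- A smooth function that grows linearly where both electrons are far from the nucleus and
tends to `-∞` linearly where `|x|_0` is much smaller than `η |x|_∞`. -/
noncomputable def conePhase (η : ℝ) (x : Config) : ℝ :=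
  (√(1 + ‖x.fst‖ ^ 2) + √(1 + ‖x.snd‖ ^ 2) -
    (1 + η) * √(1 + ‖x.fst‖ ^ 2 + ‖x.snd‖ ^ 2)) / 3

theorem sqrt_one_add_sq_le {r : ℝ} (hr : 0 ≤ r) : √(1 + r ^ 2) ≤ 1 + r :=
  Real.sqrt_le_iff.mpr ⟨by linarith, by nlinarith⟩

theorem conePhase_le {η : ℝ} (hη : 0 ≤ η) (x : Config) :
    conePhase η x ≤ (2 + normMin x - η * normMax x) / 3 := by
  have h1 := sqrt_one_add_sq_le (norm_nonneg x.fst)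
  have h2 := sqrt_one_add_sq_le (norm_nonneg x.snd)
  have h3 := normMax_le_sqrt x
  have h4 : normMax x + normMin x = ‖x.fst‖ + ‖x.snd‖ := max_add_min _ _
  have h5 := mul_le_mul_of_nonneg_left h3 (by linarith : 0 ≤ 1 + η)
  unfold conePhase
  linarith

/-- The Euclidean norm is at most `|x|_∞ + |x|_0 / 2`, so `|x₁| + |x₂| - |x|` is at least
`|x|_0 / 2`. -/
theorem le_conePhase {η : ℝ} (hη : 0 ≤ η) (x : Config) :
    ((1 - η) / 2 * normMin x - η * normMax x - (1 + η)) / 3 ≤ conePhase η x := by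
  have h1 : ‖x.fst‖ ≤ √(1 + ‖x.fst‖ ^ 2) := Real.le_sqrt_of_sq_le (by linarith)
  have h2 : ‖x.snd‖ ≤ √(1 + ‖x.snd‖ ^ 2) := Real.le_sqrt_of_sq_le (by linarith)
  have h4 : normMax x + normMin x = ‖x.fst‖ + ‖x.snd‖ := max_add_min _ _
  have h5 : normMax x * normMin x = ‖x.fst‖ * ‖x.snd‖ := max_mul_min _ _
  have h6 : normMin x ≤ normMax x := min_le_max
  have h7 : 0 ≤ normMin x := le_min (norm_nonneg _) (norm_nonneg _)
  have h3 : √(1 + ‖x.fst‖ ^ 2 + ‖x.snd‖ ^ 2) ≤ 1 + normMax x + normMin x / 2 := by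
    refine Real.sqrt_le_iff.mpr ⟨by linarith, ?_⟩
    have e : ‖x.fst‖ ^ 2 + ‖x.snd‖ ^ 2 = normMax x ^ 2 + normMin x ^ 2 := by
      linear_combination (‖x.fst‖ + ‖x.snd‖ + normMax x + normMin x) * (-h4) + 2 * h5
    nlinarith
  have h8 := mul_le_mul_of_nonneg_left h3 (by linarith : 0 ≤ 1 + η)
  unfold conePhase
  linarith

/-- The bound state decays exponentially in the region where both electrons are far from the
nucleus. The exponent `log (1 + e^L)`, with `L` the cone phase, follows `L` where `L` is positive and
has an exponentially small gradient where only the repulsion is available. -/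
theorem integrable_one_add_exp_conePhase {U d : ℝ} {ψ : StateSpace}
    (hψ : IsHamiltonianImage U ψ ((-(1 / 4) : ℂ) • ψ)) (hU : 0 ≤ U) (hd : 0 < d) (hd₁ : 2 * d < 1)
    (hκ : 0 < U / (1 + d) - 1) :
    Integrable fun x : Config =>
      Real.exp (2 * Real.log (1 + Real.exp (conePhase (2 * d) x))) / (1 + normMax x) *
        ‖ψ x‖ ^ 2 := by
  let n : Config → ℝ := fun x => √(1 + ‖x.fst‖ ^ 2 + ‖x.snd‖ ^ 2)
  let σ : Config → ℝ := fun x => Real.exp (conePhase (2 * d) x) /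
    (1 + Real.exp (conePhase (2 * d) x))
  let A : Config → ℝ := fun x => σ x * ((1 / (2 * √(1 + ‖x.fst‖ ^ 2)) -
    (1 + 2 * d) * (1 / (2 * n x))) / 3)
  let B : Config → ℝ := fun x => σ x * ((1 / (2 * √(1 + ‖x.snd‖ ^ 2)) -
    (1 + 2 * d) * (1 / (2 * n x))) / 3)
  have hσ0 : ∀ x, 0 ≤ σ x := fun x => by positivity
  have hσ1 : ∀ x, σ x ≤ 1 := fun x => by
    rw [div_le_one (by positivity)]
    linarith
  have hσ2 : ∀ x, σ x ≤ Real.exp (conePhase (2 * d) x) := fun x =>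
    div_le_self (Real.exp_pos _).le (by linarith [Real.exp_pos (conePhase (2 * d) x)])
  have c1 := continuous_fst_config
  have c2 := continuous_snd_config
  have hnc : Continuous n := by fun_prop
  have hn0 : ∀ x, 0 < n x := fun x => by positivity
  have hPc : Continuous (conePhase (2 * d)) := by
    unfold conePhase
    fun_prop
  have hσc : Continuous σ :=
    (Real.continuous_exp.comp hPc).div (continuous_const.add (Real.continuous_exp.comp hPc))
      fun x => by positivity
  have hblock : ∀ {u : Config → EuclideanSpace ℝ (Fin 3)}, Continuous u →
      (∀ x, ‖u x‖ ≤ n x) → (∀ x, √(1 + ‖u x‖ ^ 2) ≤ n x) →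
      Continuous (fun x => σ x * ((1 / (2 * √(1 + ‖u x‖ ^ 2)) -
        (1 + 2 * d) * (1 / (2 * n x))) / 3)) ∧
      ∀ x, (2 * ‖u x‖ * (σ x * ((1 / (2 * √(1 + ‖u x‖ ^ 2)) -
        (1 + 2 * d) * (1 / (2 * n x))) / 3))) ^ 2 ≤ σ x ^ 2 / 9 := by
    intro u hu hun hun'
    refine ⟨?_, fun x => ?_⟩
    · refine hσc.mul (((continuous_const.div (by fun_prop) fun x => by positivity).sub
        (continuous_const.mul (continuous_const.div (continuous_const.mul hnc) fun x => ?_))).div_const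
        _)
      exact (mul_pos two_pos (hn0 x)).ne'
    · have hρ : 0 < √(1 + ‖u x‖ ^ 2) := by positivity
      have hn := hn0 x
      have q1 : ‖u x‖ / √(1 + ‖u x‖ ^ 2) ≤ 1 := by
        rw [div_le_one hρ]
        exact Real.le_sqrt_of_sq_le (by linarith)
      have q2 : 0 ≤ ‖u x‖ / n x := by positivity
      have q3 : ‖u x‖ / n x ≤ ‖u x‖ / √(1 + ‖u x‖ ^ 2) :=
        div_le_div_of_nonneg_left (norm_nonneg _) hρ (hun' x)
      have e : 2 * ‖u x‖ * (σ x * ((1 / (2 * √(1 + ‖u x‖ ^ 2)) -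
          (1 + 2 * d) * (1 / (2 * n x))) / 3)) =
          σ x / 3 * (‖u x‖ / √(1 + ‖u x‖ ^ 2) - (1 + 2 * d) * (‖u x‖ / n x)) := by
        field_simp
      -- the difference lies between `-2d` and `1`
      have hsq : (‖u x‖ / √(1 + ‖u x‖ ^ 2) - (1 + 2 * d) * (‖u x‖ / n x)) ^ 2 ≤ 1 := by
        rw [sq_le_one_iff_abs_le_one, abs_le]
        constructor <;> nlinarith
      rw [e, mul_pow]
      calc _ ≤ (σ x / 3) ^ 2 * 1 := mul_le_mul_of_nonneg_left hsq (sq_nonneg _)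
        _ = _ := by ring
  obtain ⟨hAc, hA⟩ := hblock c1 (fun x => Real.le_sqrt_of_sq_le (by
    linarith [sq_nonneg ‖x.snd‖])) (fun x => Real.sqrt_le_sqrt (by linarith [sq_nonneg ‖x.snd‖]))
  obtain ⟨hBc, hB⟩ := hblock c2 (fun x => Real.le_sqrt_of_sq_le (by
    linarith [sq_nonneg ‖x.fst‖])) (fun x => Real.sqrt_le_sqrt (by linarith [sq_nonneg ‖x.fst‖]))
  have hsum : ∀ x, ∑ i, biradialGrad A B i x ^ 2 ≤ 2 / 9 * σ x ^ 2 := fun x => by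
    rw [sum_biradialGrad_sq]
    have h1 : (2 * ‖x.fst‖ * A x) ^ 2 ≤ σ x ^ 2 / 9 := hA x
    have h2 : (2 * ‖x.snd‖ * B x) ^ 2 ≤ σ x ^ 2 / 9 := hB x
    linarith
  have hsum' : ∀ x, ∑ i, biradialGrad A B i x ^ 2 ≤ 2 / 9 := fun x =>
    (hsum x).trans (by nlinarith [hσ0 x, hσ1 x])
  refine integrable_exp_mul_of_gap hψ hU hd (by linarith) (g := biradialGrad A B) (C := 2 / 9)
    (c := (U / (1 + d) - 1) / 4) (R := gapRadius (U / (1 + d) - 1) d)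
    ((continuous_const.add (Real.continuous_exp.comp hPc)).log fun x =>
      (add_pos one_pos (Real.exp_pos _)).ne')
    (fun x => Real.log_nonneg (by linarith [Real.exp_pos (conePhase (2 * d) x)]))
    (continuous_biradialGrad hAc hBc) hsum' ?_ (by positivity) (one_le_gapRadius hκ hd)
    (fun x hx => ?_)
  · refine hasLineDerivAt_biradial (Φ := fun s t => Real.log (1 + Real.exp
      ((√(1 + s) + √(1 + t) - (1 + 2 * d) * √(1 + s + t)) / 3))) (fun x => ?_) fun x => ?_
    · have h1 : HasDerivAt (fun s : ℝ => 1 + s + ‖x.snd‖ ^ 2) 1 (‖x.fst‖ ^ 2) :=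
        ((hasDerivAt_id _).const_add 1).add_const _
      have h2 : HasDerivAt (fun s : ℝ => 1 + s) 1 (‖x.fst‖ ^ 2) := (hasDerivAt_id _).const_add 1
      have h3 := (((((h2.sqrt (by positivity)).add_const √(1 + ‖x.snd‖ ^ 2)).sub
        ((h1.sqrt (by positivity)).const_mul (1 + 2 * d))).div_const 3).exp.const_add 1).log
        (by positivity)
      convert! h3 using 1
      simp only [A, σ, n, conePhase, Pi.sub_apply]
      ring
    · have h1 : HasDerivAt (fun s : ℝ => 1 + ‖x.fst‖ ^ 2 + s) 1 (‖x.snd‖ ^ 2) :=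
        (hasDerivAt_id _).const_add _
      have h2 : HasDerivAt (fun s : ℝ => 1 + s) 1 (‖x.snd‖ ^ 2) := (hasDerivAt_id _).const_add 1
      have h3 := (((((h2.sqrt (by positivity)).const_add √(1 + ‖x.fst‖ ^ 2)).sub
        ((h1.sqrt (by positivity)).const_mul (1 + 2 * d))).div_const 3).exp.const_add 1).log
        (by positivity)
      convert! h3 using 1
      simp only [B, σ, n, conePhase, Pi.sub_apply]
      ring
  · have hM : 0 < normMax x := by linarith [one_le_gapRadius hκ hd]
    have h0 : 0 ≤ (U / (1 + d) - 1) / (2 * normMax x) := by positivity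
    refine add_le_farGap hd hκ hx (fun hmin => ?_) (by linarith [hsum' x])
    have hP : 2 * conePhase (2 * d) x ≤ 2 - 2 / 3 * (d * normMax x) := by
      linarith [conePhase_le (by linarith : 0 ≤ 2 * d) x]
    have hsq : σ x ^ 2 ≤ Real.exp 2 * Real.exp (-(2 / 3 * (d * normMax x))) := by
      calc σ x ^ 2 ≤ Real.exp (conePhase (2 * d) x) ^ 2 := pow_le_pow_left₀ (hσ0 x) (hσ2 x) 2
        _ = Real.exp (2 * conePhase (2 * d) x) := by rw [← Real.exp_nat_mul]; norm_num
        _ ≤ Real.exp (2 + -(2 / 3 * (d * normMax x))) := Real.exp_le_exp.mpr (by linarith)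
        _ = _ := Real.exp_add _ _
    have hexp2 : Real.exp 2 ≤ 9 := by
      have h1 := Real.exp_one_lt_d9
      have h2 : Real.exp 2 = Real.exp 1 * Real.exp 1 := by rw [← Real.exp_add]; norm_num
      rw [h2]
      nlinarith [Real.exp_pos 1]
    have hexp : Real.exp (-(2 / 3 * (d * normMax x))) ≤ 9 / (2 * (d ^ 2 * normMax x ^ 2)) := by
      have h1 := Real.quadratic_le_exp_of_nonneg
        (by positivity : 0 ≤ 2 / 3 * (d * normMax x))
      have h2 : 0 < d * normMax x := by positivity
      rw [Real.exp_neg, ← one_div, div_le_div_iff₀ (Real.exp_pos _) (by positivity)]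
      nlinarith
    have h5 : σ x ^ 2 ≤ 9 * (9 / (2 * (d ^ 2 * normMax x ^ 2))) :=
      hsq.trans (mul_le_mul hexp2 hexp (Real.exp_pos _).le (by norm_num))
    have h6 : 9 * (9 / (2 * (d ^ 2 * normMax x ^ 2))) = 9 / 2 * (9 / (d ^ 2 * normMax x ^ 2)) := by
      field_simp
    linarith [hsum x]

/-! ### Comparison with the decay exponent -/

theorem one_add_sq_le_exp {θ s : ℝ} (hθ : 0 < θ) (hs : 0 ≤ s) :
    1 + s ^ 2 ≤ (1 + 2 / θ ^ 2) * Real.exp (θ * s) := by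
  have h := Real.quadratic_le_exp_of_nonneg (by positivity : 0 ≤ θ * s)
  have h1 : 1 ≤ Real.exp (θ * s) := Real.one_le_exp (by positivity)
  have h2 : s ^ 2 ≤ 2 / θ ^ 2 * Real.exp (θ * s) := by
    rw [div_mul_eq_mul_div, le_div_iff₀ (by positivity)]
    nlinarith [mul_nonneg hθ.le hs]
  linarith

theorem one_add_le_exp {θ s : ℝ} (hθ : 0 < θ) (hs : 0 ≤ s) :
    1 + s ≤ (1 + 1 / θ) * Real.exp (θ * s) := by
  have h := Real.add_one_le_exp (θ * s)
  have h1 : 1 ≤ Real.exp (θ * s) := Real.one_le_exp (by positivity)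
  have h2 : s ≤ 1 / θ * Real.exp (θ * s) := by
    rw [div_mul_eq_mul_div, le_div_iff₀ hθ]
    linarith
  linarith

theorem linear_coeff_le {δ τ : ℝ} (hδ : 0 < δ) (hτ : 0 < τ) (hτ₁ : τ < 1) :
    1 / (4 * (1 + Real.pi / (τ * δ))) ≤ δ / 12 := by
  have hπ := Real.pi_gt_three
  rw [div_le_div_iff₀ (by positivity) (by norm_num)]
  have h1 : δ * (Real.pi / (τ * δ)) = Real.pi / τ := by field_simp
  have h2 : Real.pi ≤ Real.pi / τ := by
    rw [le_div_iff₀ hτ]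
    nlinarith
  nlinarith

theorem sqrt_coeff_lt {U δ K d : ℝ} (hδ : 0 < δ) (hK₀ : 0 < K) (hK₂ : K < 2) (hU : 1 + δ ≤ U)
    (hd : 0 < d) (hdδ : d < δ) :
    K * √((U - 1 - δ) / (2 + 2 * δ)) < √(2 * (U / (1 + d) - 1)) := by
  have h0 : 0 ≤ (U - 1 - δ) / (2 + 2 * δ) := div_nonneg (by linarith) (by linarith)
  have h1 : (U - 1 - δ) / (2 + 2 * δ) = (U / (1 + δ) - 1) / 2 := by
    field_simp
    ring
  have h2 : U / (1 + δ) < U / (1 + d) :=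
    div_lt_div_of_pos_left (by linarith) (by linarith) (by linarith)
  refine Real.lt_sqrt_of_sq_lt ?_
  rw [mul_pow, Real.sq_sqrt h0]
  have h3 : K ^ 2 ≤ 4 := by nlinarith
  have h4 := mul_le_mul_of_nonneg_right h3 h0
  linarith

/-- The two phases dominate `F`, with room for the factor `1 + |x|_∞`: the square root phase because
its coefficient exceeds that of `F`, the cone phase because its slope on `A_δ` is at least
`5δ/48`, while that of `F` is at most `δ/12`. -/
theorem exp_decayExponent_le {U δ τ K : ℝ} (hδ₀ : 0 < δ) (hδ₁ : δ < 1) (hτ₀ : 0 < τ)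
    (hτ₁ : τ < 1) (hK₀ : 0 < K) (hK₂ : K < 2) (hU : 1 + δ ≤ U) :
    ∃ C, ∀ x : Config, Real.exp (2 * decayExponent U δ τ K x) ≤
      C * (Real.exp (2 * (√(2 * (U / (1 + δ / 16) - 1)) *
          √√(1 + ‖x.fst‖ ^ 2 + ‖x.snd‖ ^ 2))) / (1 + normMax x) +
        Real.exp (2 * Real.log (1 + Real.exp (conePhase (2 * (δ / 16)) x))) / (1 + normMax x)) := by
  set a := √(2 * (U / (1 + δ / 16) - 1))
  set k := K * √((U - 1 - δ) / (2 + 2 * δ)) with hk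
  have hka : k < a := sqrt_coeff_lt hδ₀ hK₀ hK₂ hU (by positivity) (by linarith)
  have hθ : 0 < 2 * (a - k) := by linarith
  refine ⟨(1 + 2 / (2 * (a - k)) ^ 2) + (1 + 1 / (δ / 24)) * Real.exp 1, fun x => ?_⟩
  have hM := normMax_nonneg x
  have hC₁ : 0 ≤ 1 + 2 / (2 * (a - k)) ^ 2 := by positivity
  have hC₂ : 0 ≤ (1 + 1 / (δ / 24)) * Real.exp 1 := by positivity
  rw [← add_div, ← mul_div_assoc, le_div_iff₀ (by linarith)]
  set Ea := Real.exp (2 * (a * √√(1 + ‖x.fst‖ ^ 2 + ‖x.snd‖ ^ 2)))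
  set Eb := Real.exp (2 * Real.log (1 + Real.exp (conePhase (2 * (δ / 16)) x))) with hEb
  have hEa0 : 0 < Ea := Real.exp_pos _
  have hEb0 : 0 < Eb := Real.exp_pos _
  rw [decayExponent]
  split_ifs with hx
  · have hreg : x ∈ region δ := interior_subset hx
    change δ * normMax x ≤ normMin x at hreg
    have hα := mul_le_mul_of_nonneg_right (linear_coeff_le hδ₀ hτ₀ hτ₁) hM
    have hL : 2 * (1 / (4 * (1 + Real.pi / (τ * δ))) * normMax x) + δ / 24 * normMax x - 1 ≤
        2 * conePhase (2 * (δ / 16)) x := by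
      have h1 := le_conePhase (by positivity : 0 ≤ 2 * (δ / 16)) x
      have h2 : (1 - 2 * (δ / 16)) / 2 * (δ * normMax x) ≤
          (1 - 2 * (δ / 16)) / 2 * normMin x :=
        mul_le_mul_of_nonneg_left hreg (by linarith)
      have h3 : 7 / 16 * (δ * normMax x) ≤ (1 - 2 * (δ / 16)) / 2 * (δ * normMax x) :=
        mul_le_mul_of_nonneg_right (by linarith) (by positivity)
      linarith
    have hlog : 2 * conePhase (2 * (δ / 16)) x ≤
        2 * Real.log (1 + Real.exp (conePhase (2 * (δ / 16)) x)) := by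
      have : conePhase (2 * (δ / 16)) x ≤
          Real.log (1 + Real.exp (conePhase (2 * (δ / 16)) x)) := by
        rw [Real.le_log_iff_exp_le (by positivity)]
        linarith
      linarith
    have hexp : Real.exp (2 * (1 / (4 * (1 + Real.pi / (τ * δ))) * normMax x)) *
        Real.exp (δ / 24 * normMax x) ≤ Real.exp 1 * Eb := by
      rw [hEb, ← Real.exp_add, ← Real.exp_add, Real.exp_le_exp]
      linarith
    have hpoly := one_add_le_exp (by positivity : 0 < δ / 24) hM
    have hE := Real.exp_pos (2 * (1 / (4 * (1 + Real.pi / (τ * δ))) * normMax x))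
    calc _ ≤ Real.exp (2 * (1 / (4 * (1 + Real.pi / (τ * δ))) * normMax x)) *
          ((1 + 1 / (δ / 24)) * Real.exp (δ / 24 * normMax x)) :=
          mul_le_mul_of_nonneg_left hpoly hE.le
      _ = (1 + 1 / (δ / 24)) * (Real.exp (2 * (1 / (4 * (1 + Real.pi / (τ * δ))) * normMax x)) *
          Real.exp (δ / 24 * normMax x)) := by ring
      _ ≤ (1 + 1 / (δ / 24)) * (Real.exp 1 * Eb) :=
          mul_le_mul_of_nonneg_left hexp (by positivity)
      _ ≤ _ := by
          have := mul_nonneg hC₁ (add_pos hEa0 hEb0).le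
          have := mul_nonneg hC₂ hEa0.le
          linarith
  · have hs : √(normMax x) ≤ √√(1 + ‖x.fst‖ ^ 2 + ‖x.snd‖ ^ 2) :=
      Real.sqrt_le_sqrt (normMax_le_sqrt x)
    have ha0 : 0 ≤ a := Real.sqrt_nonneg _
    have hpoly := one_add_sq_le_exp hθ (Real.sqrt_nonneg (normMax x))
    rw [Real.sq_sqrt hM] at hpoly
    have hexp : Real.exp (2 * (k * √(normMax x))) * Real.exp (2 * (a - k) * √(normMax x)) ≤
        Ea := by
      rw [← Real.exp_add, Real.exp_le_exp]
      have := mul_le_mul_of_nonneg_left hs ha0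
      linarith
    have hE := Real.exp_pos (2 * (k * √(normMax x)))
    calc _ ≤ Real.exp (2 * (k * √(normMax x))) * ((1 + 2 / (2 * (a - k)) ^ 2) *
          Real.exp (2 * (a - k) * √(normMax x))) := mul_le_mul_of_nonneg_left hpoly hE.le
      _ = (1 + 2 / (2 * (a - k)) ^ 2) * (Real.exp (2 * (k * √(normMax x))) *
          Real.exp (2 * (a - k) * √(normMax x))) := by ring
      _ ≤ (1 + 2 / (2 * (a - k)) ^ 2) * Ea := mul_le_mul_of_nonneg_left hexp hC₁
      _ ≤ _ := by
          have := mul_nonneg hC₂ (add_pos hEa0 hEb0).le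
          have := mul_nonneg hC₁ hEb0.le
          linarith

theorem measurable_decayExponent (U δ τ K : ℝ) : Measurable (decayExponent U δ τ K) := by
  have h := continuous_normMax.measurable
  unfold decayExponent
  exact Measurable.ite isOpen_interior.measurableSet (measurable_const.mul h)
    (measurable_const.mul h.sqrt)

end HeliumAtom

theorem theorem3p1 (U δ τ K : ℝ) (hδ₀ : 0 < δ) (hδ₁ : δ < 1) (hτ₀ : 0 < τ) (hτ₁ : τ < 1)
    (hK₀ : 0 < K) (hK₂ : K < 2) (hU : 1 + δ ≤ U) (ψ : HeliumAtom.StateSpace)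
    (hψ : HeliumAtom.IsHamiltonianImage U ψ ((-(1 / 4) : ℂ) • ψ)) :
    MemLp (fun x : HeliumAtom.Config =>
      (Real.exp (HeliumAtom.decayExponent U δ τ K x) : ℂ) * ψ x) 2 volume := by
  have hU0 : 0 ≤ U := by linarith
  have hκ : 0 < U / (1 + δ / 16) - 1 := by
    rw [sub_pos, lt_div_iff₀ (by linarith)]
    linarith
  have ia := HeliumAtom.integrable_exp_sqrt hψ hU0 (by positivity : 0 < δ / 16) (by linarith) hκ
  have ib := HeliumAtom.integrable_one_add_exp_conePhase hψ hU0 (by positivity : 0 < δ / 16)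
    (by linarith) hκ
  obtain ⟨C, hC⟩ := HeliumAtom.exp_decayExponent_le hδ₀ hδ₁ hτ₀ hτ₁ hK₀ hK₂ hU
  have hmeas : AEStronglyMeasurable (fun x : HeliumAtom.Config =>
      (Real.exp (HeliumAtom.decayExponent U δ τ K x) : ℂ) * ψ x) volume := by
    refine AEStronglyMeasurable.mul ?_ (Lp.aestronglyMeasurable ψ)
    exact (Complex.measurable_ofReal.comp (Real.measurable_exp.comp
      (HeliumAtom.measurable_decayExponent U δ τ K))).aestronglyMeasurable
  rw [memLp_two_iff_integrable_sq_norm hmeas]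
  refine ((ia.add ib).const_mul C).mono' (hmeas.norm.pow 2) (Filter.Eventually.of_forall
    fun x => ?_)
  have h := mul_le_mul_of_nonneg_right (hC x) (sq_nonneg ‖ψ x‖)
  have e : ‖(Real.exp (HeliumAtom.decayExponent U δ τ K x) : ℂ) * ψ x‖ ^ 2 =
      Real.exp (2 * HeliumAtom.decayExponent U δ τ K x) * ‖ψ x‖ ^ 2 := by
    rw [norm_mul, mul_pow, Complex.norm_real, Real.norm_of_nonneg (Real.exp_pos _).le,
      ← Real.exp_nat_mul]
    norm_num
  rw [Real.norm_of_nonneg (by positivity), e]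
  refine h.trans_eq ?_
  simp only [Pi.add_apply]
  ring
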